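/- All graphs are finite and simple. $P_n$ denotes the path on $n$ vertices, $2P_2$ the disjoint union of two copies of $P_2$, and $\overline{P_2+P_3}$ the complement of the disjoint union of $P_2$ and $P_3$. A graph is $(2P_2,\overline{P_2+P_3})$-free if it contains neither of these two graphs as an induced subgraph. An atom is a graph $G$ with no clique cut-set, that is, there is no (possibly empty) clique $K\subseteq V(G)$ such that $G\setminus K$ is disconnected. A graph is split if its vertex set can be partitioned into a clique and an independent set (either may be empty). The clique-width of $G$ is the minimum number of labels needed to construct $G$ by the operations: (1) create a single vertex with label $i$; (2) take the disjoint union of two labelled graphs; (3) for $i\neq j$, add an edge between every vertex with label $i$ and every vertex with label $j$; (4) change every label $i$ into label $j$. Theorem. There is an absolute constant $c$ such that every $(2P_2,\overline{P_2+P_3})$-free atom has clique-width at most $c$. In contrast, the class of all $(2P_2,\overline{P_2+P_3})$-free graphs has unbounded clique-width, that is, no constant bounds the clique-width of all its members; indeed, every split graph is $(2P_2,\overline{P_2+P_3})$-free, and already the class of split graphs has unbounded clique-width. -/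

import Mathlib

universe u

open SimpleGraph

/-- Expressions over the four clique-width operations, using labels from `Fin k`. -/
inductive CWExpr (k : ℕ) : Type
  /-- a single vertex with label `i` -/
  | vertex (i : Fin k) : CWExpr k
  /-- disjoint union -/
  | union (e₁ e₂ : CWExpr k) : CWExpr k
  /-- add all edges between the vertices labelled `i` and those labelled `j`, where `i ≠ j` -/
  | join (i j : Fin k) (hij : i ≠ j) (e : CWExpr k) : CWExpr k
  /-- give label `j` to every vertex labelled `i` -/
  | relabel (i j : Fin k) (e : CWExpr k) : CWExpr k

namespace CWExpr

/-- The vertex set of the graph built by an expression. -/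
def Vert {k : ℕ} : CWExpr k → Type
  | vertex _ => Unit
  | union e₁ e₂ => e₁.Vert ⊕ e₂.Vert
  | join _ _ _ e => e.Vert
  | relabel _ _ e => e.Vert

/-- The labels of the vertices of the graph built by an expression. -/
def label {k : ℕ} : (e : CWExpr k) → e.Vert → Fin k
  | vertex i => fun _ => i
  | union e₁ e₂ => Sum.elim e₁.label e₂.label
  | join _ _ _ e => e.label
  | relabel i j e => fun v => if e.label v = i then j else e.label v

/-- The graph built by an expression. -/
def graph {k : ℕ} : (e : CWExpr k) → SimpleGraph e.Vert
  | vertex _ => (⊥ : SimpleGraph Unit)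
  | union e₁ e₂ => e₁.graph ⊕g e₂.graph
  | join i j _ e => e.graph ⊔ SimpleGraph.fromRel (fun u v => e.label u = i ∧ e.label v = j)
  | relabel _ _ e => e.graph

end CWExpr

namespace SimpleGraph

/-- `G` can be constructed (up to isomorphism) by the four operations with `k` labels. -/
def ConstructibleWith {V : Type u} (G : SimpleGraph V) (k : ℕ) : Prop :=
  ∃ e : CWExpr k, Nonempty (e.graph ≃g G)

/-- The clique-width of a finite graph: the least number of labels with which it can be
constructed. (The graph without vertices, which needs no label, gets the value `0`.) -/
noncomputable def cliqueWidth {V : Type u} (G : SimpleGraph V) : ℕ :=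
  sInf {k : ℕ | G.ConstructibleWith k}

/-- Every finite graph with a vertex is constructible with as many labels as it has vertices,
so that the minimum in `cliqueWidth` is over a nonempty set. -/
theorem constructibleWith_card {V : Type u} [Finite V] [Nonempty V] (G : SimpleGraph V) :
    G.ConstructibleWith (Nat.card V) := by
  classical
  have A : ∀ (k n : ℕ) (f : Fin (n + 1) → Fin k), ∃ (e : CWExpr k) (φ : e.Vert ≃ Fin (n + 1)),
      (∀ x y, ¬ e.graph.Adj x y) ∧ ∀ x, e.label x = f (φ x) := by
    intro k n
    induction n with
    | zero =>
      intro f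
      refine ⟨.vertex (f 0), (Equiv.ofUnique Unit (Fin 1) : Unit ≃ Fin 1), ?_, ?_⟩
      · intro x y h
        exact h
      · intro x
        exact congrArg f (Subsingleton.elim (α := Fin 1) _ _)
    | succ n ih =>
      intro f
      obtain ⟨e, φ, h₁, h₂⟩ := ih (fun i => f i.castSucc)
      refine ⟨.union e (.vertex (f (Fin.last _))),
        ((Equiv.sumCongr φ (Equiv.ofUnique Unit (Fin 1))).trans finSumFinEquiv :
          e.Vert ⊕ Unit ≃ Fin (n + 1 + 1)), ?_, ?_⟩
      · rintro (x | x) (y | y) h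
        · exact h₁ x y h
        · exact Bool.false_ne_true h
        · exact Bool.false_ne_true h
        · exact h
      · rintro (x | x)
        · exact h₂ x
        · exact congrArg f (Fin.ext (by
            change n + 1 = n + 1 + ((0 : Fin 1) : ℕ)
            simp))
  obtain ⟨n, hn⟩ : ∃ n, Nat.card V = n + 1 := Nat.exists_eq_succ_of_ne_zero Nat.card_pos.ne'
  let ψ : Fin (n + 1) ≃ V := (Finite.equivFinOfCardEq hn).symm
  let f : V ≃ Fin (Nat.card V) := Finite.equivFin V
  have B : ∀ E : Finset (V × V), (∀ p ∈ E, p.1 ≠ p.2) →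
      ∃ (e : CWExpr (Nat.card V)) (φ : e.Vert ≃ V),
        (∀ x y, e.graph.Adj x y ↔ (φ x, φ y) ∈ E ∨ (φ y, φ x) ∈ E) ∧
        ∀ x, e.label x = f (φ x) := by
    intro E
    induction E using Finset.induction_on with
    | empty =>
      intro _
      obtain ⟨e, φ, h₁, h₂⟩ := A _ n (fun i => f (ψ i))
      exact ⟨e, φ.trans ψ, fun x y => by simp [h₁], h₂⟩
    | insert p E hp ih =>
      intro hE
      obtain ⟨e, φ, h₁, h₂⟩ := ih (fun q hq => hE q (Finset.mem_insert_of_mem hq))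
      have hne : p.1 ≠ p.2 := hE p (Finset.mem_insert_self _ _)
      refine ⟨.join (f p.1) (f p.2) (f.injective.ne hne) e, φ, ?_, h₂⟩
      change ∀ x y : e.Vert, (e.graph ⊔ SimpleGraph.fromRel
        (fun u v => e.label u = f p.1 ∧ e.label v = f p.2)).Adj x y ↔ _
      intro x y
      rw [SimpleGraph.sup_adj, SimpleGraph.fromRel_adj, h₁]
      simp only [h₂, f.injective.eq_iff, Finset.mem_insert, Prod.ext_iff]
      have hxy : ∀ w z : V, w = p.1 → z = p.2 → w ≠ z := fun w z hw hz h =>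
        hne (hw ▸ hz ▸ h)
      have hxy₁ := hxy (φ x) (φ y)
      have hxy₂ := hxy (φ y) (φ x)
      by_cases hc : x = y
      · subst hc
        tauto
      · tauto
  have : Fintype V := Fintype.ofFinite V
  obtain ⟨e, φ, h, -⟩ := B (Finset.univ.filter fun p => G.Adj p.1 p.2)
    (fun p hp => (Finset.mem_filter.1 hp).2.ne)
  refine ⟨e, ⟨⟨φ, ?_⟩⟩⟩
  intro x y
  simp [h, G.adj_comm (φ y)]

/-- `K` is a clique cut-set of `G`: a (possibly empty) clique whose deletion leaves a disconnected
graph, that is, one with two vertices not joined by a walk. -/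
def IsCliqueCutset {V : Type u} (G : SimpleGraph V) (K : Set V) : Prop :=
  G.IsClique K ∧ ¬ (G.induce Kᶜ).Preconnected

/-- A graph without clique cut-sets. -/
def IsGraphAtom {V : Type u} (G : SimpleGraph V) : Prop :=
  ∀ K : Set V, ¬ G.IsCliqueCutset K

/-- The vertex set can be partitioned into a clique and an independent set. -/
def IsSplitGraph {V : Type u} (G : SimpleGraph V) : Prop :=
  ∃ K : Set V, G.IsClique K ∧ G.IsIndepSet Kᶜ

/-- `G` does not contain `H` as an induced subgraph. -/
def IsInducedFree {W : Type} {V : Type u} (H : SimpleGraph W) (G : SimpleGraph V) : Prop :=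
  ¬ H.IsIndContained G

/-- The graph `2P₂`. -/
def twoP2 : SimpleGraph (Fin 2 ⊕ Fin 2) := pathGraph 2 ⊕g pathGraph 2

/-- The complement of `P₂ + P₃`. -/
def coP2P3 : SimpleGraph (Fin 2 ⊕ Fin 3) := (pathGraph 2 ⊕g pathGraph 3)ᶜ

/-- `(2P₂, co-(P₂ + P₃))`-free graphs. -/
def IsTwoP2CoP2P3Free {V : Type u} (G : SimpleGraph V) : Prop :=
  twoP2.IsInducedFree G ∧ coP2P3.IsInducedFree G

/-- The class of all finite graphs satisfying `P` has bounded clique-width. -/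
def HasBoundedCliqueWidth (P : ∀ {V : Type u}, SimpleGraph V → Prop) : Prop :=
  ∃ c : ℕ, ∀ (V : Type u) [Finite V] (G : SimpleGraph V), P G → G.cliqueWidth ≤ c

end SimpleGraph

/-! Bounded half. Pass to the complement `H` of the atom. It has no induced `C₄` and no induced `P₂
+ P₃`. If `v` has an `H`-neighbour, then its `G`-neighbourhood would be a clique cut-set were it a
clique, so in `H` some edge misses `v`. These three facts (`IsCoAtomLike`) are all that is used. If
`H` has an edge, comparing neighbourhoods with that of a vertex of maximum degree produces an
induced `C₅` or `2P₂`.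

With a `C₅`, the absence of `C₄` leaves three kinds of other vertices: complete to the cycle (full),
adjacent to exactly three consecutive vertices (near), or missing three consecutive ones (sparse).
Near vertices have adjacencies dictated by traces on the cycle, up to boundedly many exceptions.
Full vertices form a clique. After deleting a bounded set, sparse vertices form disjoint cliques
with at most one vertex of each trace; and, because every full vertex misses an edge between sparse
ones, full and sparse vertices are anticomplete.

Without a `C₅`, fix a `2P₂` `ab`, `cd` and let `Q` be the vertices touching both edges. If `Q` is a
clique, then `H` is either a disjoint union of cliques, or two cliques with nested neighbourhoods
plus isolated vertices. Two non-adjacent vertices of `Q` close up an induced `C₆`, which determines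
all remaining adjacencies except within components of at most two vertices.

Each structure gives a construction of `G` with few labels: `cliqueWidth_le_of_classes` builds one
class at a time, `cliqueWidth_le_of_elimination` one vertex at a time.

Unbounded half. In the split graph whose independent set realises all subsets of a clique, cut an
expression at a subexpression holding about one to two thirds of the clique. Few labels transmit too
little information across the cut to distinguish all the subsets. -/

namespace SimpleGraph

/-! ### Constructions with few labels. -/

/-- The subgraph of `G` induced by `X`, with the labels `ℓ`, is built by some expression
(no condition if `X` is empty). -/
def BuildableOn {V : Type u} {k : ℕ} (G : SimpleGraph V) (X : Finset V) (ℓ : V → Fin k) : Prop :=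
  X.Nonempty → ∃ (e : CWExpr k) (φ : e.Vert → V), Function.Injective φ ∧
    (∀ v, v ∈ X ↔ ∃ a, φ a = v) ∧ (∀ a b, e.graph.Adj a b ↔ G.Adj (φ a) (φ b)) ∧
    ∀ a, e.label a = ℓ (φ a)

namespace BuildableOn

variable {V : Type u} {k : ℕ} {G : SimpleGraph V} {X : Finset V} {ℓ ℓ' : V → Fin k}

theorem congr (h : G.BuildableOn X ℓ) (hl : ∀ v ∈ X, ℓ v = ℓ' v) : G.BuildableOn X ℓ' := by
  intro hX
  obtain ⟨e, φ, h₁, h₂, h₃, h₄⟩ := h hX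
  exact ⟨e, φ, h₁, h₂, h₃, fun a => (h₄ a).trans (hl _ ((h₂ _).2 ⟨a, rfl⟩))⟩

theorem relabel (h : G.BuildableOn X ℓ) (i j : Fin k) :
    G.BuildableOn X (fun v => if ℓ v = i then j else ℓ v) := by
  intro hX
  obtain ⟨e, φ, h₁, h₂, h₃, h₄⟩ := h hX
  refine ⟨.relabel i j e, φ, h₁, h₂, h₃, fun a => ?_⟩
  change (if e.label a = i then j else e.label a) = _
  rw [h₄ a]

theorem singleton (G : SimpleGraph V) (v : V) (ℓ : V → Fin k) : G.BuildableOn {v} ℓ := by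
  intro _
  refine ⟨.vertex (ℓ v), fun _ => v, ?_, ?_, ?_, fun _ => rfl⟩
  · intro a b _
    exact Subsingleton.elim (α := Unit) a b
  · intro w
    rw [Finset.mem_singleton]
    exact ⟨fun h => ⟨(), h.symm⟩, fun ⟨_, h⟩ => h.symm⟩
  · intro a b
    exact ⟨fun h => absurd h (by exact id), fun h => absurd rfl h.ne⟩

theorem empty (G : SimpleGraph V) (ℓ : V → Fin k) : G.BuildableOn ∅ ℓ :=
  fun h => absurd h (by simp)

/-- A vertex whose label is not in use can be added if its neighbours are determined by their
labels. -/
theorem insert [DecidableEq V] (h : G.BuildableOn X ℓ) {v : V} (hv : v ∉ X)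
    (hl : ∀ x ∈ X, ℓ x ≠ ℓ v)
    (hG : ∀ x ∈ X, ∀ y ∈ X, ℓ x = ℓ y → G.Adj v x → G.Adj v y) :
    G.BuildableOn (insert v X) ℓ := by
  classical
  intro _
  rcases X.eq_empty_or_nonempty with rfl | hX
  · simpa using singleton G v ℓ (by simp)
  obtain ⟨e, φ, h₁, h₂, h₃, h₄⟩ := h hX
  have hφ : ∀ a, φ a ∈ X := fun a => (h₂ _).2 ⟨a, rfl⟩
  -- Since the label of `v` is used by no other vertex, a join with one further label changes only
  -- the neighbourhood of `v`. In the end `T` is the set of labels of the neighbours of `v`.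
  have key : ∀ T : Finset (Fin k), ℓ v ∉ T → ∃ (e : CWExpr k) (φ : e.Vert → V),
      Function.Injective φ ∧ (∀ w, w ∈ Insert.insert v X ↔ ∃ a, φ a = w) ∧
      (∀ a b, e.graph.Adj a b ↔ (φ a ∈ X ∧ φ b ∈ X ∧ G.Adj (φ a) (φ b)) ∨
        (φ a = v ∧ φ b ∈ X ∧ ℓ (φ b) ∈ T) ∨ (φ b = v ∧ φ a ∈ X ∧ ℓ (φ a) ∈ T)) ∧
      ∀ a, e.label a = ℓ (φ a) := by
    intro T
    induction T using Finset.induction_on with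
    | empty =>
      intro _
      refine ⟨.union e (.vertex (ℓ v)), fun a : e.Vert ⊕ Unit => Sum.elim φ (fun _ => v) a,
        ?_, ?_, ?_, ?_⟩
      · rintro (a | a) (b | b) hab
        · exact congrArg Sum.inl (h₁ hab)
        · exact absurd (show φ a = v from hab) (fun h => hv (h ▸ hφ a))
        · exact absurd (show v = φ b from hab) (fun h => hv (h ▸ hφ b))
        · rfl
      · intro w
        rw [Finset.mem_insert]
        constructor
        · rintro (rfl | hw)
          · exact ⟨Sum.inr (), rfl⟩
          · obtain ⟨a, ha⟩ := (h₂ w).1 hw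
            exact ⟨Sum.inl a, ha⟩
        · rintro ⟨a | a, rfl⟩
          · exact Or.inr (hφ a)
          · exact Or.inl rfl
      · rintro (a | a) (b | b)
        · exact (h₃ a b).trans ⟨fun h => Or.inl ⟨hφ a, hφ b, h⟩, fun h => h.elim (fun h => h.2.2)
            fun h => h.elim (fun h => absurd h.2.2 (Finset.notMem_empty _))
              fun h => absurd h.2.2 (Finset.notMem_empty _)⟩
        · exact ⟨fun h => absurd h Bool.false_ne_true, fun h => h.elim (fun h => absurd h.2.1 hv)
            fun h => h.elim (fun h => absurd h.2.2 (Finset.notMem_empty _))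
              fun h => absurd h.2.2 (Finset.notMem_empty _)⟩
        · exact ⟨fun h => absurd h Bool.false_ne_true, fun h => h.elim (fun h => absurd h.1 hv)
            fun h => h.elim (fun h => absurd h.2.2 (Finset.notMem_empty _))
              fun h => absurd h.2.2 (Finset.notMem_empty _)⟩
        · exact ⟨fun h => absurd h (by exact id), fun h => h.elim (fun h => absurd h.1 hv)
            fun h => h.elim (fun h => absurd h.2.2 (Finset.notMem_empty _))
              fun h => absurd h.2.2 (Finset.notMem_empty _)⟩
      · rintro (a | a)
        · exact h₄ a
        · rfl
    | insert i T hi ih =>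
      intro hT
      obtain ⟨e, φ, h₁, h₂, h₃, h₄⟩ := ih (fun h => hT (Finset.mem_insert_of_mem h))
      have hne : ℓ v ≠ i := fun h => hT (h ▸ Finset.mem_insert_self _ _)
      refine ⟨.join (ℓ v) i hne e, φ, h₁, h₂, ?_, h₄⟩
      change ∀ a b : e.Vert, (e.graph ⊔ SimpleGraph.fromRel
        (fun u w => e.label u = ℓ v ∧ e.label w = i)).Adj a b ↔ _
      intro a b
      rw [SimpleGraph.sup_adj, SimpleGraph.fromRel_adj, h₃]
      simp only [h₄, Finset.mem_insert]
      have hX' : ∀ a, φ a = v ∨ φ a ∈ X := fun a => Finset.mem_insert.1 ((h₂ _).2 ⟨a, rfl⟩)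
      have hv' : ∀ a, ℓ (φ a) = ℓ v ↔ φ a = v := fun a =>
        ⟨fun h => (hX' a).resolve_right fun h' => hl _ h' h, fun h => h ▸ rfl⟩
      have hi' : ∀ a, ℓ (φ a) = i → φ a ∈ X := fun a h => (hX' a).resolve_left
        fun h' => hne (by rw [← h', h])
      rw [hv', hv']
      rcases hX' a with ha | ha <;> rcases hX' b with hb | hb
      · have hab : a = b := h₁ (ha.trans hb.symm)
        simp [hab, hb, hv]
      · have h1 : φ b ≠ v := fun h => hv (h ▸ hb)
        have h2 : a ≠ b := fun h => h1 (h ▸ ha)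
        simp [ha, hb, h1, h2, hv, or_comm]
      · have h1 : φ a ≠ v := fun h => hv (h ▸ ha)
        have h2 : a ≠ b := fun h => h1 (h ▸ hb)
        simp [ha, hb, h1, h2, hv, or_comm]
      · have h1 : φ a ≠ v := fun h => hv (h ▸ ha)
        have h2 : φ b ≠ v := fun h => hv (h ▸ hb)
        simp [h1, h2]
  obtain ⟨e, φ, h₁, h₂, h₃, h₄⟩ := key ((X.filter (G.Adj v)).image ℓ) (by
    rw [Finset.mem_image]
    rintro ⟨x, hx, hxv⟩
    exact hl x (Finset.mem_filter.1 hx).1 hxv)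
  refine ⟨e, φ, h₁, h₂, fun a b => ?_, h₄⟩
  have hT : ∀ x ∈ X, (ℓ x ∈ (X.filter (G.Adj v)).image ℓ ↔ G.Adj v x) := by
    intro x hx
    rw [Finset.mem_image]
    constructor
    · rintro ⟨y, hy, hyx⟩
      exact hG y (Finset.mem_filter.1 hy).1 x hx hyx (Finset.mem_filter.1 hy).2
    · exact fun hvx => ⟨x, Finset.mem_filter.2 ⟨hx, hvx⟩, rfl⟩
  have hX' : ∀ a, φ a = v ∨ φ a ∈ X := fun a => Finset.mem_insert.1 ((h₂ _).2 ⟨a, rfl⟩)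
  rw [h₃]
  rcases hX' a with ha | ha <;> rcases hX' b with hb | hb
  · simp [ha, hb, hv]
  · have : φ b ≠ v := fun h => hv (h ▸ hb)
    rw [hT _ hb, ha]
    simp [hb, hv, this]
  · have : φ a ≠ v := fun h => hv (h ▸ ha)
    rw [hT _ ha, hb]
    simp [ha, hv, this, G.adj_comm]
  · have h1 : φ b ≠ v := fun h => hv (h ▸ hb)
    have h2 : φ a ≠ v := fun h => hv (h ▸ ha)
    simp [ha, hb, h1, h2]

theorem constructibleWith [Fintype V] [Nonempty V] (h : G.BuildableOn Finset.univ ℓ) :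
    G.ConstructibleWith k := by
  obtain ⟨e, φ, h₁, h₂, h₃, -⟩ := h Finset.univ_nonempty
  refine ⟨e, ⟨⟨Equiv.ofBijective φ ⟨h₁, fun v => (h₂ v).1 (Finset.mem_univ v)⟩, ?_⟩⟩⟩
  intro a b
  exact (h₃ a b).symm

end BuildableOn

theorem ConstructibleWith.cliqueWidth_le {V : Type u} {G : SimpleGraph V} {k : ℕ}
    (h : G.ConstructibleWith k) : G.cliqueWidth ≤ k := Nat.sInf_le h

/-- Every expression creates a vertex, so no number of labels works and the infimum of the empty set
takes its default value `0`. -/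
theorem cliqueWidth_of_isEmpty {V : Type u} [IsEmpty V] (G : SimpleGraph V) :
    G.cliqueWidth = 0 := by
  have hne : ∀ {k : ℕ} (e : CWExpr k), Nonempty e.Vert := by
    intro k e
    induction e with
    | vertex i => exact ⟨()⟩
    | union e₁ e₂ h₁ h₂ => exact ⟨Sum.inl h₁.some⟩
    | join i j h e ih => exact ih
    | relabel i j e ih => exact ih
  have : {k : ℕ | G.ConstructibleWith k} = ∅ := by
    ext k
    simp only [Set.mem_ofPred_eq, Set.mem_empty_iff_false, iff_false]
    rintro ⟨e, ⟨f⟩⟩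
    exact IsEmpty.false (f (hne e).some)
  rw [cliqueWidth, this, Nat.sInf_empty]

/-- If every nonempty vertex set contains a vertex whose neighbours in the set are determined by
their colours, then the clique-width is at most the number of colours plus one. -/
theorem cliqueWidth_le_of_elimination {V : Type u} [Finite V] (G : SimpleGraph V) {p : ℕ}
    (c : V → Fin p)
    (h : ∀ X : Finset V, X.Nonempty → ∃ v ∈ X, ∀ x ∈ X, ∀ y ∈ X, x ≠ v → y ≠ v → c x = c y →
      G.Adj v x → G.Adj v y) : G.cliqueWidth ≤ p + 1 := by
  classical
  have := Fintype.ofFinite V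
  rcases isEmpty_or_nonempty V with hV | hV
  · rw [cliqueWidth_of_isEmpty]
    exact Nat.zero_le _
  -- The extra label `Fin.last p` is held by the newest vertex only while it is being joined; it is
  -- then recoloured.
  have key : ∀ (n : ℕ) (X : Finset V), X.card = n →
      G.BuildableOn X (fun v => (c v).castSucc) := by
    intro n
    induction n with
    | zero =>
      intro X hX
      rw [Finset.card_eq_zero.1 hX]
      exact .empty _ _
    | succ n ih =>
      intro X hX
      obtain ⟨v, hv, hvX⟩ := h X (Finset.card_pos.1 (by omega))
      have h₁ := (ih (X.erase v) (by rw [Finset.card_erase_of_mem hv]; omega)).congr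
        (ℓ' := fun w => if w = v then Fin.last p else (c w).castSucc) (by
          intro w hw
          rw [if_neg (Finset.ne_of_mem_erase hw)])
      have h₂ := h₁.insert (v := v) (by simp) (by
          intro x hx
          simp only [if_neg (Finset.ne_of_mem_erase hx), if_true]
          exact (Fin.castSucc_lt_last _).ne) (by
          intro x hx y hy hxy
          simp only [if_neg (Finset.ne_of_mem_erase hx), if_neg (Finset.ne_of_mem_erase hy)] at hxy
          exact hvX x (Finset.mem_of_mem_erase hx) y (Finset.mem_of_mem_erase hy)
            (Finset.ne_of_mem_erase hx) (Finset.ne_of_mem_erase hy)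
            (Fin.castSucc_injective _ hxy))
      rw [Finset.insert_erase hv] at h₂
      refine (h₂.relabel (Fin.last p) (c v).castSucc).congr ?_
      intro w _
      by_cases hw : w = v
      · simp [hw]
      · simp [hw, (Fin.castSucc_lt_last _).ne]
  exact (key _ Finset.univ rfl).constructibleWith.cliqueWidth_le

/-- Adding a vertex with an unused label and then giving it a label in use. -/
theorem BuildableOn.insert_of_fresh {V : Type u} [DecidableEq V] {k : ℕ} {G : SimpleGraph V}
    {X : Finset V} {ℓ : V → Fin k} (h : G.BuildableOn X ℓ) {v : V} (hv : v ∉ X) (i : Fin k)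
    (hi : ∀ w, ℓ w ≠ i)
    (hG : ∀ x ∈ X, ∀ y ∈ X, ℓ x = ℓ y → G.Adj v x → G.Adj v y) :
    G.BuildableOn (Insert.insert v X) ℓ := by
  have hX : ∀ x ∈ X, x ≠ v := fun x hx hxv => hv (hxv ▸ hx)
  have h₁ := (h.congr (ℓ' := fun w => if w = v then i else ℓ w)
    (fun w hw => by rw [if_neg (hX w hw)])).insert (v := v) hv
    (fun x hx => by simpa [hX x hx] using hi x)
    (fun x hx y hy hxy => hG x hx y hy (by simpa [hX x hx, hX y hy] using hxy))
  refine (h₁.relabel i (ℓ v)).congr fun w _ => ?_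
  by_cases hw : w = v
  · simp [hw]
  · simp [hw, hi]

/-- Let `r` be an equivalence relation such that the adjacency of vertices in different classes is
determined by colours from `α`, and that of vertices in the same class by slots from `β`. Then the
clique-width is bounded. -/
theorem cliqueWidth_le_of_classes {V : Type u} [Finite V] (G : SimpleGraph V) {α β : Type}
    [Fintype α] [Fintype β] (r : Setoid V) (c : V → α) (slot : V → β)
    (hout : ∀ u v u' v', ¬ r u v → ¬ r u' v' → c u = c u' → c v = c v' → G.Adj u v → G.Adj u' v')
    (hin : ∀ v x y, r v x → r v y → x ≠ v → y ≠ v → slot x = slot y → G.Adj v x → G.Adj v y)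
    (hc : ∀ x y, r x y → slot x = slot y → c x = c y) :
    G.cliqueWidth ≤ Fintype.card α + Fintype.card β + 1 := by
  classical
  have := Fintype.ofFinite V
  rcases isEmpty_or_nonempty V with hV | hV
  · rw [cliqueWidth_of_isEmpty]
    exact Nat.zero_le _
  -- `none` marks the vertex being inserted, `inr` carries the slots of the class under
  -- construction, and `inl` the colours of finished classes.
  let e : Option (α ⊕ β) ≃ Fin (Fintype.card α + Fintype.card β + 1) :=
    Fintype.equivFinOfCardEq (by simp)
  have key : ∀ (n : ℕ) (X : Finset V), X.card ≤ n → (∀ x ∈ X, ∀ y, r x y → y ∈ X) →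
      G.BuildableOn X (fun v => e (some (Sum.inl (c v)))) := by
    intro n
    induction n with
    | zero =>
      intro X hX _
      rw [Finset.card_eq_zero.1 (Nat.le_zero.1 hX)]
      exact .empty _ _
    | succ n ih =>
      intro X hX hcl
      rcases X.eq_empty_or_nonempty with rfl | ⟨v₀, hv₀⟩
      · exact .empty _ _
      set D := X.filter (fun v => r v₀ v) with hD
      have hDX : D ⊆ X := Finset.filter_subset _ _
      have hv₀D : v₀ ∈ D := Finset.mem_filter.2 ⟨hv₀, r.refl v₀⟩
      have hDr : ∀ x ∈ D, ∀ y ∈ D, r x y := fun x hx y hy =>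
        r.trans (r.symm (Finset.mem_filter.1 hx).2) (Finset.mem_filter.1 hy).2
      have hDr' : ∀ x ∈ D, ∀ y ∈ X, y ∉ D → ¬ r x y := fun x hx y hy hyD hxy =>
        hyD (Finset.mem_filter.2 ⟨hy, r.trans (Finset.mem_filter.1 hx).2 hxy⟩)
      have h₁ := ih (X \ D) (by
          have := Finset.card_lt_card (Finset.sdiff_ssubset hDX ⟨v₀, hv₀D⟩)
          omega) (by
          intro x hx y hxy
          rw [Finset.mem_sdiff] at hx ⊢
          refine ⟨hcl x hx.1 y hxy, fun hy => hx.2 ?_⟩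
          exact Finset.mem_filter.2 ⟨hx.1, r.trans (Finset.mem_filter.1 hy).2 (r.symm hxy)⟩)
      let f : V → Option (α ⊕ β) := fun v =>
        if v ∈ D then some (Sum.inr (slot v)) else some (Sum.inl (c v))
      have h₂ : ∀ D' : Finset V, D' ⊆ D → G.BuildableOn (D' ∪ (X \ D)) (fun v => e (f v)) := by
        intro D'
        induction D' using Finset.induction_on with
        | empty =>
          intro _
          rw [Finset.empty_union]
          exact h₁.congr fun v hv => by simp [f, (Finset.mem_sdiff.1 hv).2]
        | insert v D' hv ihD =>
          intro hD'
          have hvD : v ∈ D := hD' (Finset.mem_insert_self _ _)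
          have hD'D : D' ⊆ D := fun x hx => hD' (Finset.mem_insert_of_mem hx)
          have hsub : ∀ x ∈ D' ∪ (X \ D), x ∈ X ∧ x ≠ v := by
            intro x hx
            rcases Finset.mem_union.1 hx with hx | hx
            · exact ⟨hDX (hD'D hx), fun h => hv (h ▸ hx)⟩
            · exact ⟨(Finset.mem_sdiff.1 hx).1, fun h => (Finset.mem_sdiff.1 hx).2 (h ▸ hvD)⟩
          rw [Finset.insert_union]
          refine (ihD hD'D).insert_of_fresh (fun h => (hsub v h).2 rfl) (e none) ?_ ?_
          · intro w hw
            have := e.injective hw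
            simp only [f] at this
            split_ifs at this
          · intro x hx y hy hxy
            have hxy := e.injective hxy
            simp only [f] at hxy
            by_cases hxD : x ∈ D <;> by_cases hyD : y ∈ D
            · simp only [if_pos hxD, if_pos hyD] at hxy
              exact hin v x y (hDr v hvD x hxD) (hDr v hvD y hyD) (hsub x hx).2 (hsub y hy).2
                (Sum.inr_injective (Option.some_injective _ hxy))
            · simp [hxD, hyD] at hxy
            · simp [hxD, hyD] at hxy
            · simp only [if_neg hxD, if_neg hyD] at hxy
              exact hout v x v y (hDr' v hvD x (hsub x hx).1 hxD)
                (hDr' v hvD y (hsub y hy).1 hyD) rfl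
                (Sum.inl_injective (Option.some_injective _ hxy))
      -- Once the class is complete its slots are traded for colours one slot at a time; `J` records
      -- those already traded. Each slot has a single colour within the class, by `hc`.
      have h₃ : ∀ J : Finset β, G.BuildableOn X (fun v =>
          e (if v ∈ D ∧ slot v ∉ J then some (Sum.inr (slot v)) else some (Sum.inl (c v)))) := by
        intro J
        induction J using Finset.induction_on with
        | empty =>
          have := h₂ D subset_rfl
          rw [Finset.union_sdiff_of_subset hDX] at this
          exact this.congr fun v _ => by simp [f]
        | insert j J hj ihJ =>
          by_cases hjD : ∃ w ∈ D, slot w = j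
          · obtain ⟨w, hw, hwj⟩ := hjD
            refine (ihJ.relabel (e (some (Sum.inr j))) (e (some (Sum.inl (c w))))).congr ?_
            intro v _
            by_cases hv : v ∈ D
            · by_cases hvj : slot v = j
              · have : c v = c w := hc v w (hDr v hv w hw) (hvj.trans hwj.symm)
                simp [hvj, hj, hv, this]
              · by_cases hvJ : slot v ∈ J
                · simp [hvJ, hv]
                · simp [hvJ, hv, hvj]
            · simp [hv]
          · refine ihJ.congr fun v _ => ?_
            by_cases hv : v ∈ D
            · have : slot v ≠ j := fun h => hjD ⟨v, hv, h⟩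
              simp [hv, this]
            · simp [hv]
      exact (h₃ Finset.univ).congr fun v _ => by simp
  exact (key _ Finset.univ le_rfl (fun _ _ _ _ => Finset.mem_univ _)).constructibleWith.cliqueWidth_le

/-- Let the adjacency of vertices in different classes of `r`, outside of a small set `S`, be
determined by their neighbourhoods in `S`. If `r` has small classes outside `S`, then the
clique-width is bounded. -/
theorem cliqueWidth_le_of_small_classes {V : Type u} [Finite V] (G : SimpleGraph V) {s m : ℕ}
    (S : Finset V) (hS : S.card ≤ s) (r : V → V → Prop)
    (hsymm : ∀ u v, u ∉ S → v ∉ S → r u v → r v u)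
    (htrans : ∀ u v w, u ∉ S → v ∉ S → w ∉ S → r u v → r v w → r u w)
    (slot : V → Fin m) (hslot : ∀ u v, u ∉ S → v ∉ S → r u v → slot u = slot v → u = v)
    (hout : ∀ u v u' v', u ∉ S → v ∉ S → u' ∉ S → v' ∉ S → u ≠ v → u' ≠ v' →
      ¬ r u v → ¬ r u' v' →
      (∀ x ∈ S, (G.Adj u x ↔ G.Adj u' x)) → (∀ x ∈ S, (G.Adj v x ↔ G.Adj v' x)) →
      G.Adj u v → G.Adj u' v') :
    G.cliqueWidth ≤ s + 2 ^ s + m + 1 := by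
  classical
  obtain ⟨ι⟩ : Nonempty (S ↪ Fin s) := by
    rw [Function.Embedding.nonempty_iff_card_le]
    simpa using hS
  -- Vertices of `S` become singleton classes, so that `S` itself is covered by the same argument.
  let r' : Setoid V :=
    { r := fun u v => u = v ∨ (u ∉ S ∧ v ∉ S ∧ r u v)
      iseqv := by
        refine ⟨fun u => Or.inl rfl, ?_, ?_⟩
        · rintro u v (h | ⟨hu, hv, h⟩)
          · exact Or.inl h.symm
          · exact Or.inr ⟨hv, hu, hsymm u v hu hv h⟩
        · rintro u v w (rfl | ⟨hu, hv, h⟩) (rfl | ⟨hv', hw, h'⟩)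
          · exact Or.inl rfl
          · exact Or.inr ⟨hv', hw, h'⟩
          · exact Or.inr ⟨hu, hv, h⟩
          · exact Or.inr ⟨hu, hw, htrans u v w hu hv hw h h'⟩ }
  have hr' : ∀ u v, r' u v ↔ (u = v ∨ (u ∉ S ∧ v ∉ S ∧ r u v)) := fun _ _ => Iff.rfl
  let nb : V → Finset (Fin s) := fun v => Finset.univ.filter fun i => ∃ x : S, ι x = i ∧ G.Adj v x
  have hnb : ∀ u v, nb u = nb v → ∀ x ∈ S, (G.Adj u x ↔ G.Adj v x) := by
    intro u v huv x hx
    have h := fun i => Finset.ext_iff.1 huv i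
    have := h (ι ⟨x, hx⟩)
    simpa [nb, hx] using this
  -- A private colour for each vertex of `S`, and the trace on `S` for all others: `s + 2 ^ s`
  -- colours. As `slot` is injective on classes, the conditions inside a class are trivial.
  let c : V → Fin s ⊕ Finset (Fin s) := fun v =>
    if h : v ∈ S then Sum.inl (ι ⟨v, h⟩) else Sum.inr (nb v)
  have hcS : ∀ u v, c u = c v → u ∈ S → u = v := by
    intro u v huv hu
    by_cases hv : v ∈ S
    · simp only [c, dif_pos hu, dif_pos hv] at huv
      have := ι.injective (Sum.inl_injective huv)
      exact congrArg Subtype.val this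
    · simp [c, hu, hv] at huv
  have hcS' : ∀ u v, c u = c v → u ∉ S → v ∉ S ∧ ∀ x ∈ S, (G.Adj u x ↔ G.Adj v x) := by
    intro u v huv hu
    by_cases hv : v ∈ S
    · simp [c, hu, hv] at huv
    · simp only [c, dif_neg hu, dif_neg hv] at huv
      exact ⟨hv, hnb u v (Sum.inr_injective huv)⟩
  have hid : ∀ u v, r' u v → slot u = slot v → u = v := by
    intro u v huv hs
    rcases (hr' u v).1 huv with h | ⟨hu, hv, h⟩
    · exact h
    · exact hslot u v hu hv h hs
  have := cliqueWidth_le_of_classes G r' c slot ?_ ?_ ?_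
  · simpa using this
  · intro u v u' v' huv huv' hu hv hadj
    rw [hr', not_or] at huv huv'
    by_cases huS : u ∈ S
    · obtain rfl := hcS u u' hu huS
      by_cases hvS : v ∈ S
      · obtain rfl := hcS v v' hv hvS
        exact hadj
      · exact (((hcS' v v' hv hvS).2 u huS).1 hadj.symm).symm
    · obtain ⟨huS', hu'⟩ := hcS' u u' hu huS
      by_cases hvS : v ∈ S
      · obtain rfl := hcS v v' hv hvS
        exact (hu' v hvS).1 hadj
      · obtain ⟨hvS', hv'⟩ := hcS' v v' hv hvS
        exact hout u v u' v' huS hvS huS' hvS' huv.1 huv'.1 (fun h => huv.2 ⟨huS, hvS, h⟩)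
          (fun h => huv'.2 ⟨huS', hvS', h⟩) hu' hv' hadj
  · intro v x y hvx hvy _ _ hs
    rw [hid x y (r'.trans (r'.symm hvx) hvy) hs]
    exact id
  · intro x y hxy hs
    rw [hid x y hxy hs]

/-! ### Split graphs: membership in the class and unbounded clique-width. -/

theorem IsSplitGraph.isTwoP2CoP2P3Free {V : Type u} {G : SimpleGraph V} (h : G.IsSplitGraph) :
    G.IsTwoP2CoP2P3Free := by
  obtain ⟨K, hK, hI⟩ := h
  have hK' : ∀ x y, x ∈ K → y ∈ K → x ≠ y → G.Adj x y := fun x y hx hy => hK hx hy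
  have hI' : ∀ x y, x ∉ K → y ∉ K → ¬ G.Adj x y := fun x y hx hy hxy => hI hx hy hxy.ne hxy
  constructor
  · rintro ⟨f⟩
    have hf : ∀ x y, G.Adj (f x) (f y) ↔ twoP2.Adj x y := fun x y => f.map_rel_iff
    have hne : ∀ x y, x ≠ y → f x ≠ f y := fun x y h => f.injective.ne h
    have h₁ : G.Adj (f (.inl 0)) (f (.inl 1)) := (hf _ _).2 (by simp [twoP2, pathGraph_adj])
    have h₂ : G.Adj (f (.inr 0)) (f (.inr 1)) := (hf _ _).2 (by simp [twoP2, pathGraph_adj])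
    have h₃ : ∀ i j, ¬ G.Adj (f (.inl i)) (f (.inr j)) := fun i j h =>
      absurd ((hf _ _).1 h) (by simp [twoP2])
    have h₄ : ∀ i j, f (.inl i) ∉ K ∨ f (.inr j) ∉ K := fun i j => by
      by_contra! h
      exact h₃ i j (hK' _ _ h.1 h.2 (hne _ _ (by simp)))
    have h₅ := h₄ 0 0
    have h₆ := h₄ 0 1
    have h₇ := h₄ 1 0
    have h₈ := h₄ 1 1
    have h₉ := fun h h' => hI' _ _ h h' h₁
    have h₀ := fun h h' => hI' _ _ h h' h₂
    tauto
  · rintro ⟨f⟩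
    have hf : ∀ x y, G.Adj (f x) (f y) ↔ coP2P3.Adj x y := fun x y => f.map_rel_iff
    have hne : ∀ x y, x ≠ y → f x ≠ f y := fun x y h => f.injective.ne h
    have h₁ : ∀ i j, G.Adj (f (.inl i)) (f (.inr j)) := fun i j =>
      (hf _ _).2 (by simp [coP2P3])
    have h₂ : ¬ G.Adj (f (.inl 0)) (f (.inl 1)) := fun h =>
      absurd ((hf _ _).1 h) (by simp [coP2P3, pathGraph_adj])
    have h₃ : ¬ G.Adj (f (.inr 0)) (f (.inr 1)) := fun h =>
      absurd ((hf _ _).1 h) (by simp [coP2P3, pathGraph_adj])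
    -- The clique omits a vertex of each of two non-adjacent pairs that are complete to each other;
    -- the two omitted vertices are adjacent in the independent part.
    have h₄ : f (.inl 0) ∉ K ∨ f (.inl 1) ∉ K := by
      by_contra! h
      exact h₂ (hK' _ _ h.1 h.2 (hne _ _ (by simp)))
    have h₅ : f (.inr 0) ∉ K ∨ f (.inr 1) ∉ K := by
      by_contra! h
      exact h₃ (hK' _ _ h.1 h.2 (hne _ _ (by simp)))
    have h₆ := fun i j h h' => hI' _ _ h h' (h₁ i j)
    rcases h₄ with h | h <;> rcases h₅ with h' | h' <;> exact h₆ _ _ h h'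

theorem ncard_eq_preimage_inl_add_preimage_inr {α β : Type*} (A : Set (α ⊕ β)) (hA : A.Finite) :
    A.ncard = (Sum.inl ⁻¹' A).ncard + (Sum.inr ⁻¹' A).ncard := by
  have h := Set.image_preimage_inl_union_image_preimage_inr A
  rw [← Set.ncard_image_of_injective (Sum.inl ⁻¹' A) (Sum.inl_injective (β := β)),
    ← Set.ncard_image_of_injective (Sum.inr ⁻¹' A) (Sum.inr_injective (α := α)),
    ← Set.ncard_union_eq Set.disjoint_image_inl_image_inr
      (hA.subset (Set.image_preimage_subset _ _)) (hA.subset (Set.image_preimage_subset _ _)), h]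

/-- An expression with `k` labels has a subexpression whose share of a given vertex set `A` is
between `t` and `2t`. -/
theorem _root_.CWExpr.exists_balanced {k : ℕ} (t : ℕ) (ht : 1 ≤ t) (e : CWExpr k) :
    ∀ A : Set e.Vert, A.Finite → t ≤ A.ncard → ∃ (X : Set e.Vert) (f : e.Vert → Fin k),
      t ≤ (A ∩ X).ncard ∧ (A ∩ X).ncard ≤ 2 * t ∧ ∀ u ∈ X, ∀ v ∈ X, f u = f v →
        e.label u = e.label v ∧ ∀ w ∉ X, e.graph.Adj u w → e.graph.Adj v w := by
  induction e with
  | vertex i =>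
    intro A _ hA
    refine ⟨Set.univ, fun _ => i, by simpa using hA, ?_, fun u _ v _ _ => ⟨rfl, fun w hw => absurd trivial hw⟩⟩
    have : (A ∩ Set.univ).ncard ≤ 1 := by
      have hs : Subsingleton (CWExpr.vertex i : CWExpr k).Vert := inferInstanceAs (Subsingleton Unit)
      exact Set.ncard_le_one_of_subsingleton _
    omega
  | join i j hij e ih =>
    change ∀ A : Set e.Vert, _
    intro A hA hA'
    obtain ⟨X, f, h₁, h₂, h₃⟩ := ih A hA hA'
    refine ⟨X, f, h₁, h₂, ?_⟩
    change ∀ u ∈ X, ∀ v ∈ X, f u = f v → e.label u = e.label v ∧ ∀ w ∉ X,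
      (e.graph ⊔ SimpleGraph.fromRel (fun u v => e.label u = i ∧ e.label v = j)).Adj u w →
      (e.graph ⊔ SimpleGraph.fromRel (fun u v => e.label u = i ∧ e.label v = j)).Adj v w
    -- Equality of the current labels is carried through the induction precisely so that later joins
    -- treat `u` and `v` alike.
    refine fun u hu v hv huv => ⟨(h₃ u hu v hv huv).1, fun w hw => ?_⟩
    obtain ⟨hl, hadj⟩ := h₃ u hu v hv huv
    have hvw : v ≠ w := fun h => hw (h ▸ hv)
    rw [SimpleGraph.sup_adj, SimpleGraph.sup_adj, SimpleGraph.fromRel_adj,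
      SimpleGraph.fromRel_adj, hl]
    exact Or.imp (hadj w hw) fun h => ⟨hvw, h.2⟩
  | relabel i j e ih =>
    change ∀ A : Set e.Vert, _
    intro A hA hA'
    obtain ⟨X, f, h₁, h₂, h₃⟩ := ih A hA hA'
    refine ⟨X, f, h₁, h₂, fun u hu v hv huv => ⟨?_, (h₃ u hu v hv huv).2⟩⟩
    change (if e.label u = i then j else e.label u) = (if e.label v = i then j else e.label v)
    rw [(h₃ u hu v hv huv).1]
  | union e₁ e₂ ih₁ ih₂ =>
    change ∀ A : Set (e₁.Vert ⊕ e₂.Vert), _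
    intro A hA hA'
    have hsum := ncard_eq_preimage_inl_add_preimage_inr A hA
    have hA₁ : (Sum.inl ⁻¹' A).Finite := hA.preimage Sum.inl_injective.injOn
    have hA₂ : (Sum.inr ⁻¹' A).Finite := hA.preimage Sum.inr_injective.injOn
    by_cases h₁ : t ≤ (Sum.inl ⁻¹' A).ncard
    · obtain ⟨X, f, h₂, h₃, h₄⟩ := ih₁ _ hA₁ h₁
      have himg : A ∩ Sum.inl '' X = Sum.inl '' (Sum.inl ⁻¹' A ∩ X) := by
        rw [Set.image_preimage_inter]
      have hc : (A ∩ Sum.inl '' X).ncard = (Sum.inl ⁻¹' A ∩ X).ncard := by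
        rw [himg, Set.ncard_image_of_injective _ Sum.inl_injective]
      refine ⟨Sum.inl '' X, fun u : e₁.Vert ⊕ e₂.Vert => Sum.elim f e₂.label u,
        hc ▸ h₂, hc ▸ h₃, ?_⟩
      rintro _ ⟨u, hu, rfl⟩ _ ⟨v, hv, rfl⟩ huv
      obtain ⟨hl, hadj⟩ := h₄ u hu v hv huv
      refine ⟨hl, ?_⟩
      rintro (w | w) hw h
      · exact hadj w (fun hwX => hw ⟨w, hwX, rfl⟩) h
      · exact absurd h Bool.false_ne_true
    by_cases h₁' : t ≤ (Sum.inr ⁻¹' A).ncard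
    · obtain ⟨X, f, h₂, h₃, h₄⟩ := ih₂ _ hA₂ h₁'
      have himg : A ∩ Sum.inr '' X = Sum.inr '' (Sum.inr ⁻¹' A ∩ X) := by
        rw [Set.image_preimage_inter]
      have hc : (A ∩ Sum.inr '' X).ncard = (Sum.inr ⁻¹' A ∩ X).ncard := by
        rw [himg, Set.ncard_image_of_injective _ Sum.inr_injective]
      refine ⟨Sum.inr '' X, fun u : e₁.Vert ⊕ e₂.Vert => Sum.elim e₁.label f u,
        hc ▸ h₂, hc ▸ h₃, ?_⟩
      rintro _ ⟨u, hu, rfl⟩ _ ⟨v, hv, rfl⟩ huv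
      obtain ⟨hl, hadj⟩ := h₄ u hu v hv huv
      refine ⟨hl, ?_⟩
      rintro (w | w) hw h
      · exact absurd h Bool.false_ne_true
      · exact hadj w (fun hwX => hw ⟨w, hwX, rfl⟩) h
    -- Both halves contain fewer than `t` vertices of `A`, so this node holds fewer than `2t`.
    refine ⟨Set.univ, (CWExpr.union e₁ e₂).label, ?_, ?_, ?_⟩
    · exact hA'.trans_eq (congrArg Set.ncard (Set.inter_univ A).symm)
    · refine (congrArg Set.ncard (Set.inter_univ A)).trans_le ?_
      omega
    · exact fun u _ v _ huv => ⟨huv, fun w hw => absurd trivial hw⟩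

/-- The split graph formed by a clique and an independent set whose vertices have all the subsets
of the clique as neighbourhoods. -/
def powersetSplitGraph (α : Type u) : SimpleGraph (α ⊕ Set α) where
  Adj := fun
    | .inl i, .inl j => i ≠ j
    | .inl i, .inr s => i ∈ s
    | .inr s, .inl i => i ∈ s
    | .inr _, .inr _ => False
  symm := ⟨by
    rintro (i | s) (j | s') h
    · exact Ne.symm h
    · exact h
    · exact h
    · exact h⟩
  loopless := ⟨by
    rintro (i | s) h
    · exact h rfl
    · exact h⟩

theorem isSplitGraph_powersetSplitGraph (α : Type u) : (powersetSplitGraph α).IsSplitGraph := by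
  refine ⟨Set.range Sum.inl, ?_, ?_⟩
  · rintro _ ⟨i, rfl⟩ _ ⟨j, rfl⟩ h
    exact fun h' => h (h' ▸ rfl)
  · rintro (i | s) hi (j | s') hj _
    · exact absurd ⟨i, rfl⟩ hi
    · exact absurd ⟨i, rfl⟩ hi
    · exact absurd ⟨j, rfl⟩ hj
    · exact id

/-- Cut the expression so that the part `B` of the clique inside `X` has between `t` and `2t`
elements; then its complement in the clique also has at most `2t`. Encoding subsets across the cut
gives `2 ^ (3t) ≤ (l + 2 ^ l) * 2 ^ (2t)`, whereas `l + 2 ^ l < 2 ^ (l + 1) ≤ 2 ^ t`. -/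
theorem not_constructibleWith_powersetSplitGraph {α : Type u} [Finite α] {l t : ℕ}
    (hα : Nat.card α = 3 * t) (hl : l < t) : ¬ (powersetSplitGraph α).ConstructibleWith l := by
  classical
  have := Fintype.ofFinite α
  rintro ⟨e, ⟨φ⟩⟩
  have : Finite e.Vert := Finite.of_equiv _ φ.toEquiv.symm
  have hinj : Function.Injective fun i : α => φ.symm (Sum.inl i) :=
    φ.symm.injective.comp Sum.inl_injective
  have hA : (Set.range fun i : α => φ.symm (Sum.inl i)).ncard = 3 * t := by
    rw [← Set.image_univ, Set.ncard_image_of_injective _ hinj,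
      Set.ncard_univ, hα]
  obtain ⟨X, f, h₁, h₂, h₃⟩ := e.exists_balanced t (by omega)
    (Set.range fun i : α => φ.symm (Sum.inl i)) (Set.toFinite _) (by omega)
  set B : Set α := {i | φ.symm (Sum.inl i) ∈ X} with hB
  have hBX : (Set.range fun i : α => φ.symm (Sum.inl i)) ∩ X =
      (fun i : α => φ.symm (Sum.inl i)) '' B := by
    ext v
    constructor
    · rintro ⟨⟨i, rfl⟩, hi⟩
      exact ⟨i, hi, rfl⟩
    · rintro ⟨i, hi, rfl⟩
      exact ⟨⟨i, rfl⟩, hi⟩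
  rw [hBX, Set.ncard_image_of_injective _ hinj] at h₁ h₂
  have hadj : ∀ i s, (e.graph.Adj (φ.symm (Sum.inl i)) (φ.symm (Sum.inr s)) ↔ i ∈ s) :=
    fun i s => φ.symm.map_rel_iff
  -- If the vertex of `s` lies in `X`, its class under `f` decides `s` outside `B`. Otherwise,
  -- clique vertices of `X` in one class are all in `s` or all outside, so the set of classes met
  -- decides `s` inside `B`. The rest of `s` is recorded directly.
  let F : Set α → (Fin l × Set B) ⊕ (Set (Fin l) × Set (Bᶜ : Set α)) := fun s =>
    if φ.symm (Sum.inr s) ∈ X then Sum.inl (f (φ.symm (Sum.inr s)), {i | (i : α) ∈ s})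
    else Sum.inr ({j | ∃ i ∈ B, i ∈ s ∧ f (φ.symm (Sum.inl i)) = j}, {i | (i : α) ∈ s})
  have hF : Function.Injective F := by
    have key : ∀ s s', F s = F s' → s ⊆ s' := by
      intro s s' h i his
      by_cases hs : φ.symm (Sum.inr s) ∈ X <;> by_cases hs' : φ.symm (Sum.inr s') ∈ X
      · simp only [F, if_pos hs, if_pos hs', Sum.inl.injEq, Prod.mk.injEq] at h
        by_cases hi : i ∈ B
        · exact (Set.ext_iff.1 h.2 ⟨i, hi⟩).1 his
        · rw [← hadj]
          exact ((h₃ _ hs _ hs' h.1).2 _ hi ((hadj i s).2 his).symm).symm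
      · simp [F, hs, hs'] at h
      · simp [F, hs, hs'] at h
      · simp only [F, if_neg hs, if_neg hs', Sum.inr.injEq, Prod.mk.injEq] at h
        by_cases hi : i ∈ B
        · obtain ⟨j, hj, hjs, hji⟩ := (Set.ext_iff.1 h.1 (f (φ.symm (Sum.inl i)))).1
            ⟨i, hi, his, rfl⟩
          rw [← hadj]
          exact (h₃ _ hj _ hi hji).2 _ hs' ((hadj j s').2 hjs)
        · exact (Set.ext_iff.1 h.2 ⟨i, hi⟩).1 his
    exact fun s s' h => (key s s' h).antisymm (key s' s h.symm)
  have hcard := Nat.card_le_card_of_injective F hF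
  have hBc : Nat.card (Bᶜ : Set α) + Nat.card B = 3 * t := by
    rw [← hα, Nat.card_coe_set_eq, Nat.card_coe_set_eq, add_comm, Set.ncard_add_ncard_compl]
  rw [← Nat.card_coe_set_eq] at h₁ h₂
  have hset : ∀ β : Type u, [Finite β] → Nat.card (Set β) = 2 ^ Nat.card β := by
    intro β _
    have := Fintype.ofFinite β
    simp
  rw [Nat.card_sum, Nat.card_prod, Nat.card_prod, hset, hset, hset, hα] at hcard
  have h₅ : Nat.card (Set (Fin l)) = 2 ^ l := by simp
  rw [h₅, Nat.card_fin] at hcard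
  have h₆ : 2 ^ Nat.card B ≤ 2 ^ (2 * t) := Nat.pow_le_pow_right (by norm_num) h₂
  have h₇ : 2 ^ Nat.card (Bᶜ : Set α) ≤ 2 ^ (2 * t) :=
    Nat.pow_le_pow_right (by norm_num) (by omega)
  have h₈ : 2 ^ (3 * t) ≤ (l + 2 ^ l) * 2 ^ (2 * t) := by
    refine hcard.trans ?_
    rw [add_mul]
    exact Nat.add_le_add (Nat.mul_le_mul_left _ h₆) (Nat.mul_le_mul_left _ h₇)
  have h₉ : 2 ^ (3 * t) = 2 ^ t * 2 ^ (2 * t) := by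
    rw [← pow_add]
    congr 1
    ring
  rw [h₉] at h₈
  have h₁₀ := Nat.le_of_mul_le_mul_right h₈ (by positivity)
  have h₁₁ : 2 ^ (l + 1) ≤ 2 ^ t := Nat.pow_le_pow_right (by norm_num) hl
  have h₁₂ : l < 2 ^ l := Nat.lt_two_pow_self
  rw [pow_succ] at h₁₁
  omega

theorem not_hasBoundedCliqueWidth_isSplitGraph :
    ¬ HasBoundedCliqueWidth.{u} (fun G => G.IsSplitGraph) := by
  rintro ⟨c, hc⟩
  have h := hc _ _ (isSplitGraph_powersetSplitGraph (ULift.{u} (Fin (3 * (c + 1)))))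
  have hmem := Nat.sInf_mem (s := {k | (powersetSplitGraph
    (ULift.{u} (Fin (3 * (c + 1))))).ConstructibleWith k}) ⟨_, constructibleWith_card _⟩
  exact not_constructibleWith_powersetSplitGraph (t := c + 1) (by simp)
    (Nat.lt_succ_of_le h) hmem

/-! ### The complement of an atom. -/

/-- `H` has no induced cycle on four vertices and no induced `P₂ + P₃`, and every vertex with a
neighbour is anticomplete to some edge. -/
structure IsCoAtomLike {V : Type u} (H : SimpleGraph V) : Prop where
  noC4 : ∀ w x y z, H.Adj w x → H.Adj x y → H.Adj y z → H.Adj z w → w ≠ y → x ≠ z →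
    ¬ H.Adj w y → ¬ H.Adj x z → False
  noP2P3 : ∀ u v p q r, H.Adj u v → H.Adj p q → H.Adj q r → p ≠ r → ¬ H.Adj p r →
    ¬ H.Adj u p → ¬ H.Adj u q → ¬ H.Adj u r → ¬ H.Adj v p → ¬ H.Adj v q → ¬ H.Adj v r → False
  exists_missed : ∀ v w, H.Adj v w → ∃ x y, H.Adj x y ∧ ¬ H.Adj v x ∧ ¬ H.Adj v y

/-- `x₀ x₁ x₂ x₃ x₄` is an induced cycle of `H`. -/
structure IsInducedC5 {V : Type u} (H : SimpleGraph V) (x₀ x₁ x₂ x₃ x₄ : V) : Prop where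
  a₀₁ : H.Adj x₀ x₁
  a₁₂ : H.Adj x₁ x₂
  a₂₃ : H.Adj x₂ x₃
  a₃₄ : H.Adj x₃ x₄
  a₄₀ : H.Adj x₄ x₀
  n₀₂ : ¬ H.Adj x₀ x₂
  n₁₃ : ¬ H.Adj x₁ x₃
  n₂₄ : ¬ H.Adj x₂ x₄
  n₃₀ : ¬ H.Adj x₃ x₀
  n₄₁ : ¬ H.Adj x₄ x₁

theorem compl_not_adj {V : Type u} {G : SimpleGraph V} {x y : V} (h : Gᶜ.Adj x y) :
    ¬ G.Adj x y := h.2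

theorem IsCoAtomLike.of_compl {V : Type u} {G : SimpleGraph V} (h : G.IsTwoP2CoP2P3Free)
    (h' : G.IsGraphAtom) : Gᶜ.IsCoAtomLike where
  noC4 := by
    intro w x y z hwx hxy hyz hzw hwy hxz nwy nxz
    have nwy' : G.Adj w y := by
      by_contra hc
      exact nwy ⟨hwy, hc⟩
    have nxz' : G.Adj x z := by
      by_contra hc
      exact nxz ⟨hxz, hc⟩
    have e₁ := hwx.ne; have e₂ := hxy.ne; have e₃ := hyz.ne; have e₄ := hzw.ne
    have n₁ := compl_not_adj hwx; have n₂ := compl_not_adj hxy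
    have n₃ := compl_not_adj hyz; have n₄ := compl_not_adj hzw
    have n₁' := compl_not_adj hwx.symm; have n₂' := compl_not_adj hxy.symm
    have n₃' := compl_not_adj hyz.symm; have n₄' := compl_not_adj hzw.symm
    refine h.1 ⟨⟨⟨Sum.elim ![w, y] ![x, z], ?_⟩, ?_⟩⟩
    · rintro (i | i) (j | j) <;> fin_cases i <;> fin_cases j <;>
        simp [hwy, hwy.symm, hxz, hxz.symm, e₁, e₁.symm, e₂, e₂.symm, e₃, e₃.symm, e₄, e₄.symm]
    · change ∀ a b, G.Adj (Sum.elim ![w, y] ![x, z] a) (Sum.elim ![w, y] ![x, z] b) ↔ _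
      rintro (i | i) (j | j) <;> fin_cases i <;> fin_cases j <;>
        simp [twoP2, pathGraph_adj, n₁, n₂, n₃, n₄, n₁', n₂', n₃', n₄', nwy', nwy'.symm, nxz',
          nxz'.symm]
  noP2P3 := by
    intro u v p q r huv hpq hqr hpr npr up uq ur vp vq vr
    have e1 : u ≠ p := by rintro rfl; exact uq hpq
    have e2 : u ≠ q := by rintro rfl; exact ur hqr
    have e3 : u ≠ r := by rintro rfl; exact uq hqr.symm
    have e4 : v ≠ p := by rintro rfl; exact vq hpq
    have e5 : v ≠ q := by rintro rfl; exact vr hqr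
    have e6 : v ≠ r := by rintro rfl; exact vq hqr.symm
    have hG : ∀ x y, x ≠ y → ¬ Gᶜ.Adj x y → G.Adj x y := fun x y h h' => by
      by_contra hc
      exact h' ⟨h, hc⟩
    have e7 := huv.ne; have e8 := hpq.ne; have e9 := hqr.ne
    have f1 := hG _ _ e1 up; have f2 := hG _ _ e2 uq; have f3 := hG _ _ e3 ur
    have f4 := hG _ _ e4 vp; have f5 := hG _ _ e5 vq; have f6 := hG _ _ e6 vr
    have f7 := hG _ _ hpr npr
    have n₁ := compl_not_adj huv; have n₂ := compl_not_adj hpq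
    have n₃ := compl_not_adj hqr; have n₁' := compl_not_adj huv.symm
    have n₂' := compl_not_adj hpq.symm; have n₃' := compl_not_adj hqr.symm
    refine h.2 ⟨⟨⟨Sum.elim ![u, v] ![p, q, r], ?_⟩, ?_⟩⟩
    · rintro (i | i) (j | j) <;> fin_cases i <;> fin_cases j <;>
        simp [e1, e2, e3, e4, e5, e6, e7, e8, e9, e1.symm, e2.symm, e3.symm, e4.symm, e5.symm,
          e6.symm, e7.symm, e8.symm, e9.symm, hpr, hpr.symm]
    · change ∀ a b, G.Adj (Sum.elim ![u, v] ![p, q, r] a) (Sum.elim ![u, v] ![p, q, r] b) ↔ _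
      rintro (i | i) (j | j) <;> fin_cases i <;> fin_cases j <;>
        simp [coP2P3, pathGraph_adj, n₁, n₂, n₃, n₁', n₂', n₃', f1, f2, f3, f4, f5, f6, f7, f1.symm,
          f2.symm, f3.symm, f4.symm, f5.symm, f6.symm, f7.symm]
  exists_missed := by
    intro v w hvw
    by_contra! hc
    -- If no edge of the complement misses `v`, the `G`-neighbours of `v` form a clique, and
    -- deleting them isolates `v` from its non-neighbour `w`.
    refine h' (G.neighborSet v) ⟨?_, ?_⟩
    · intro x hx y hy hxy
      by_contra hn
      exact (hc x y ⟨hxy, hn⟩ (fun h => h.2 hx)).2 hy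
    · intro hcon
      obtain ⟨p⟩ := hcon ⟨v, fun h => G.loopless.irrefl v h⟩ ⟨w, hvw.2⟩
      cases p with
      | nil => exact hvw.ne rfl
      | @cons _ z _ hadj _ => exact z.2 hadj

/-- Let `v` have maximum degree and let the edge `xy` miss it. As `x` has the neighbour `y` outside
`N(v)`, maximality gives a neighbour `x'` of `v` not adjacent to `x`; likewise `y'` for `y`. If
`x'y` and `y'x` are edges, the absence of `C₄` makes `v x' y x y'` an induced `C₅`; otherwise `vx'`
or `vy'` forms a `2P₂` with `xy`. -/
theorem IsCoAtomLike.exists_C5_or_2P2 {V : Type u} [Finite V] {H : SimpleGraph V}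
    (h : H.IsCoAtomLike) (hne : H ≠ ⊥) :
    (∃ x₀ x₁ x₂ x₃ x₄, H.IsInducedC5 x₀ x₁ x₂ x₃ x₄) ∨
    ∃ a b c d, H.Adj a b ∧ H.Adj c d ∧ ¬ H.Adj a c ∧ ¬ H.Adj a d ∧ ¬ H.Adj b c ∧ ¬ H.Adj b d := by
  classical
  have := Fintype.ofFinite V
  obtain ⟨u, w, huw⟩ := SimpleGraph.ne_bot_iff_exists_adj.1 hne
  obtain ⟨v, -, hv⟩ := Finset.exists_max_image Finset.univ (fun v => H.degree v) ⟨u, Finset.mem_univ u⟩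
  obtain ⟨v', hv'⟩ : ∃ v', H.Adj v v' := by
    have h₁ := hv u (Finset.mem_univ u)
    have h₂ : 0 < H.degree u := (H.degree_pos_iff_exists_adj u).2 ⟨w, huw⟩
    exact (H.degree_pos_iff_exists_adj v).1 (h₂.trans_le h₁)
  obtain ⟨x, y, hxy, hvx, hvy⟩ := h.exists_missed v v' hv'
  have key : ∀ x y, H.Adj x y → ¬ H.Adj v x → ¬ H.Adj v y → ∃ x', H.Adj v x' ∧ ¬ H.Adj x x' := by
    intro x y hxy hvx hvy
    by_contra! hc
    have : H.neighborFinset v ⊂ H.neighborFinset x := by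
      rw [Finset.ssubset_iff_of_subset]
      · exact ⟨y, by simpa using hxy, by simpa using hvy⟩
      · intro z hz
        simpa using hc z (by simpa using hz)
    have := Finset.card_lt_card this
    rw [card_neighborFinset_eq_degree, card_neighborFinset_eq_degree] at this
    exact absurd (hv x (Finset.mem_univ x)) (by omega)
  obtain ⟨x', hx', hxx'⟩ := key x y hxy hvx hvy
  obtain ⟨y', hy', hyy'⟩ := key y x hxy.symm hvy hvx
  by_cases h₁ : H.Adj x' y
  · by_cases h₂ : H.Adj y' x
    · have h₃ : ¬ H.Adj x' y' := fun h₃ => h.noC4 x' y x y' h₁ hxy.symm h₂.symm h₃.symm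
        (fun h => hvx (h ▸ hx')) (fun h => hvy (h ▸ hy')) (fun h => hxx' h.symm) hyy'
      exact Or.inl ⟨v, x', y, x, y', hx', h₁, hxy.symm, h₂.symm, hy'.symm, hvy,
        fun h => hxx' h.symm, hyy', fun h => hvx h.symm, fun h => h₃ h.symm⟩
    · exact Or.inr ⟨v, y', x, y, hy', hxy, hvx, hvy, h₂, fun h => hyy' h.symm⟩
  · exact Or.inr ⟨v, x', x, y, hx', hxy, hvx, hvy, fun h => hxx' h.symm, h₁⟩

/-! ### Clique-width bounds read off from the complement. -/

theorem cliqueWidth_compl_le_of_small_classes {V : Type u} [Finite V] (H : SimpleGraph V) {s m : ℕ}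
    (S : Finset V) (hS : S.card ≤ s) (r : V → V → Prop)
    (hsymm : ∀ u v, u ∉ S → v ∉ S → r u v → r v u)
    (htrans : ∀ u v w, u ∉ S → v ∉ S → w ∉ S → r u v → r v w → r u w)
    (slot : V → Fin m) (hslot : ∀ u v, u ∉ S → v ∉ S → r u v → slot u = slot v → u = v)
    (hout : ∀ u v u' v', u ∉ S → v ∉ S → u' ∉ S → v' ∉ S → u ≠ v → u' ≠ v' →
      ¬ r u v → ¬ r u' v' →
      (∀ x ∈ S, (H.Adj u x ↔ H.Adj u' x)) → (∀ x ∈ S, (H.Adj v x ↔ H.Adj v' x)) →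
      H.Adj u v → H.Adj u' v') :
    Hᶜ.cliqueWidth ≤ s + 2 ^ s + m + 1 := by
  refine cliqueWidth_le_of_small_classes Hᶜ S hS r hsymm htrans slot hslot ?_
  intro u v u' v' hu hv hu' hv' huv huv' hr hr' h₁ h₂ hadj
  have key : ∀ u u', u ∉ S → u' ∉ S → (∀ x ∈ S, (Hᶜ.Adj u x ↔ Hᶜ.Adj u' x)) →
      ∀ x ∈ S, (H.Adj u' x ↔ H.Adj u x) := by
    intro u u' hu hu' h x hx
    have := h x hx
    have h₁ : u ≠ x := fun h => hu (h ▸ hx)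
    have h₂ : u' ≠ x := fun h => hu' (h ▸ hx)
    rw [compl_adj, compl_adj] at this
    tauto
  exact ⟨huv', fun h => hadj.2 (hout u' v' u v hu' hv' hu hv huv' huv hr' hr
    (key u u' hu hu' h₁) (key v v' hv hv' h₂) h)⟩

/-- `H` is a disjoint union of cliques, so its complement is complete multipartite: one colour, one
slot and the fresh label suffice. -/
theorem cliqueWidth_compl_le_of_transitive {V : Type u} [Finite V] (H : SimpleGraph V)
    (h : ∀ p q r, H.Adj p q → H.Adj q r → p ≠ r → H.Adj p r) : Hᶜ.cliqueWidth ≤ 3 := by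
  let r : Setoid V :=
    { r := fun u v => u = v ∨ H.Adj u v
      iseqv := by
        refine ⟨fun u => Or.inl rfl, ?_, ?_⟩
        · rintro u v (h | h)
          · exact Or.inl h.symm
          · exact Or.inr h.symm
        · rintro u v w (rfl | h₁) (rfl | h₂)
          · exact Or.inl rfl
          · exact Or.inr h₂
          · exact Or.inr h₁
          · by_cases huw : u = w
            · exact Or.inl huw
            · exact Or.inr (h u v w h₁ h₂ huw) }
  have := cliqueWidth_le_of_classes Hᶜ r (fun _ => ()) (fun _ => ())
    (fun u v u' v' _ hr _ _ _ => ⟨fun h => hr (Or.inl h), fun h => hr (Or.inr h)⟩)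
    (fun v x y hx _ hxv _ _ hadj => absurd (hx.resolve_left (Ne.symm hxv)) hadj.2)
    (fun _ _ _ _ => rfl)
  simpa using this

/-- The case of two cliques with nested neighbourhoods and further isolated vertices. -/
theorem cliqueWidth_compl_le_of_two_cliques {V : Type u} [Finite V] {H : SimpleGraph V}
    (h : H.IsCoAtomLike) (c : V → Fin 3)
    (h₀ : ∀ x y, c x = 0 → c y = 0 → x ≠ y → H.Adj x y)
    (h₁ : ∀ x y, c x = 1 → c y = 1 → x ≠ y → H.Adj x y)
    (h₂ : ∀ x y, c x = 2 → ¬ H.Adj x y) : Hᶜ.cliqueWidth ≤ 4 := by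
  classical
  refine cliqueWidth_le_of_elimination Hᶜ c fun X hX => ?_
  have hc : ∀ x, c x = 0 ∨ c x = 1 ∨ c x = 2 := fun x => by
    have : ∀ i : Fin 3, i = 0 ∨ i = 1 ∨ i = 2 := by decide
    exact this _
  have suff : (∃ v ∈ X, ∀ x ∈ X, ∀ y ∈ X, x ≠ v → y ≠ v → c x = c y → H.Adj v y → H.Adj v x) →
      ∃ v ∈ X, ∀ x ∈ X, ∀ y ∈ X, x ≠ v → y ≠ v → c x = c y → Hᶜ.Adj v x → Hᶜ.Adj v y := by
    rintro ⟨v, hv, hvX⟩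
    exact ⟨v, hv, fun x hx y hy hxv hyv hxy hadj =>
      ⟨hyv.symm, fun hadj' => hadj.2 (hvX x hx y hy hxv hyv hxy hadj')⟩⟩
  apply suff
  by_cases hX₂ : ∃ v ∈ X, c v = 2
  · obtain ⟨v, hv, hv₂⟩ := hX₂
    exact ⟨v, hv, fun x _ y _ _ _ _ hy => absurd hy (h₂ v y hv₂)⟩
  push Not at hX₂
  by_cases hX₀ : ∃ v ∈ X, c v = 0
  swap
  · push Not at hX₀
    obtain ⟨v, hv⟩ := hX
    have h' : ∀ x ∈ X, c x = 1 := fun x hx =>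
      ((hc x).resolve_left (hX₀ x hx)).resolve_right (hX₂ x hx)
    exact ⟨v, hv, fun x hx y _ hxv _ _ _ => h₁ v x (h' v hv) (h' x hx) hxv.symm⟩
  -- Without `C₄` the neighbourhoods across the two cliques are nested. So either `k`, with the most
  -- neighbours across, is complete to the other clique, or a vertex `l` missed by `k` is missed by
  -- its whole clique. That vertex is eliminated.
  obtain ⟨k, hk, hkmax⟩ := Finset.exists_max_image (X.filter (fun v => c v = 0))
    (fun v => (X.filter (fun w => c w = 1 ∧ H.Adj v w)).card)
    (by obtain ⟨v, hv, hv₀⟩ := hX₀; exact ⟨v, Finset.mem_filter.2 ⟨hv, hv₀⟩⟩)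
  rw [Finset.mem_filter] at hk
  by_cases hl : ∃ l ∈ X, c l = 1 ∧ ¬ H.Adj k l
  swap
  · push Not at hl
    refine ⟨k, hk.1, fun x hx _ _ hxk _ _ _ => ?_⟩
    rcases hc x with hx' | hx' | hx'
    · exact h₀ k x hk.2 hx' hxk.symm
    · exact hl x hx hx'
    · exact absurd hx' (hX₂ x hx)
  obtain ⟨l, hl, hl₁, hkl⟩ := hl
  have hl' : ∀ k' ∈ X, c k' = 0 → ¬ H.Adj l k' := by
    intro k' hk' hk'₀ hadj
    have hkk' : k ≠ k' := fun h' => hkl (h' ▸ hadj.symm)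
    have : ∃ l' ∈ X, c l' = 1 ∧ H.Adj k l' ∧ ¬ H.Adj k' l' := by
      by_contra! hcon
      refine absurd (hkmax k' (Finset.mem_filter.2 ⟨hk', hk'₀⟩)) (not_le.2 ?_)
      apply Finset.card_lt_card
      rw [Finset.ssubset_iff_of_subset]
      · exact ⟨l, by simp [hl, hl₁, hadj.symm], by simp [hkl]⟩
      · intro w hw
        rw [Finset.mem_filter] at hw ⊢
        exact ⟨hw.1, hw.2.1, hcon w hw.1 hw.2.1 hw.2.2⟩
    obtain ⟨l', -, hl'₁, hkl', hk'l'⟩ := this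
    have hll' : l' ≠ l := fun h' => hkl (h' ▸ hkl')
    exact h.noC4 k l' l k' hkl' (h₁ _ _ hl'₁ hl₁ hll') hadj (h₀ _ _ hk'₀ hk.2 hkk'.symm)
      (fun h' => by simp [← h', hk.2] at hl₁) (fun h' => by simp [h', hk'₀] at hl'₁) hkl
      (fun h' => hk'l' h'.symm)
  refine ⟨l, hl, fun x hx y hy hxl hyl hxy hadj => ?_⟩
  rcases hc x with hx' | hx' | hx'
  · exact absurd hadj (hl' y hy (hxy ▸ hx'))
  · exact h₁ _ _ hl₁ hx' hxl.symm
  · exact absurd hx' (hX₂ x hx)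

/-! ### An induced `2P₂` and no induced `C₅`. -/

/-- `ab` and `cd` form an induced `2P₂`. -/
structure IsInduced2P2 {V : Type u} (H : SimpleGraph V) (a b c d : V) : Prop where
  ab : H.Adj a b
  cd : H.Adj c d
  nac : ¬ H.Adj a c
  nad : ¬ H.Adj a d
  nbc : ¬ H.Adj b c
  nbd : ¬ H.Adj b d

namespace IsInduced2P2

variable {V : Type u} {H : SimpleGraph V} {a b c d : V}

theorem swap (h : H.IsInduced2P2 a b c d) : H.IsInduced2P2 c d a b :=
  ⟨h.cd, h.ab, fun k => h.nac k.symm, fun k => h.nbc k.symm, fun k => h.nad k.symm,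
    fun k => h.nbd k.symm⟩

theorem flip_left (h : H.IsInduced2P2 a b c d) : H.IsInduced2P2 b a c d :=
  ⟨h.ab.symm, h.cd, h.nbc, h.nbd, h.nac, h.nad⟩

theorem flip_right (h : H.IsInduced2P2 a b c d) : H.IsInduced2P2 a b d c :=
  ⟨h.ab, h.cd.symm, h.nad, h.nac, h.nbd, h.nbc⟩

theorem not_adj_one (h : H.IsInduced2P2 a b c d) (hH : H.IsCoAtomLike) {v : V}
    (hva : H.Adj v a) (hv : v ≠ b) (hvb : ¬ H.Adj v b) (hvc : ¬ H.Adj v c) (hvd : ¬ H.Adj v d) :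
    False :=
  hH.noP2P3 c d v a b h.cd hva h.ab hv hvb (fun k => hvc k.symm) (fun k => h.nac k.symm)
    (fun k => h.nbc k.symm) (fun k => hvd k.symm) (fun k => h.nad k.symm) (fun k => h.nbd k.symm)

/-- Two non-adjacent vertices that both touch `cd` have no common neighbour among `a`, `b`. -/
theorem no_common_left (h : H.IsInduced2P2 a b c d) (hH : H.IsCoAtomLike)
    (hC5 : ∀ x₀ x₁ x₂ x₃ x₄, ¬ H.IsInducedC5 x₀ x₁ x₂ x₃ x₄) {p q : V} (hpq : p ≠ q)
    (npq : ¬ H.Adj p q) (hp : H.Adj p c ∨ H.Adj p d) (hq : H.Adj q c ∨ H.Adj q d)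
    (hpa : H.Adj p a) (hqa : H.Adj q a) : False := by
  have hac : a ≠ c := fun k => h.nad (k ▸ h.cd)
  have had : a ≠ d := fun k => h.nac (k ▸ h.cd.symm)
  have npq' : ¬ H.Adj q p := fun k => npq k.symm
  by_cases h₁ : H.Adj p c ∧ H.Adj q c
  · exact hH.noC4 p a q c hpa hqa.symm h₁.2 h₁.1.symm hpq hac npq h.nac
  by_cases h₂ : H.Adj p d ∧ H.Adj q d
  · exact hH.noC4 p a q d hpa hqa.symm h₂.2 h₂.1.symm hpq had npq h.nad
  -- With no common neighbour among `c`, `d` either, the two vertices use different ends of `cd`,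
  -- closing a `C₅` through `a`.
  by_cases h₃ : H.Adj p c
  · have h₄ : ¬ H.Adj q c := fun k => h₁ ⟨h₃, k⟩
    have h₅ := hq.resolve_left h₄
    exact hC5 a p c d q ⟨hpa.symm, h₃, h.cd, h₅.symm, hqa, h.nac, fun k => h₂ ⟨k, h₅⟩,
      fun k => h₄ k.symm, fun k => h.nad k.symm, npq'⟩
  · have h₄ := hp.resolve_left h₃
    have h₅ : ¬ H.Adj q d := fun k => h₂ ⟨h₄, k⟩
    have h₆ := hq.resolve_right h₅
    exact hC5 a p d c q ⟨hpa.symm, h₄, h.cd.symm, h₆.symm, hqa, h.nad, h₃,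
      fun k => h₅ k.symm, fun k => h.nac k.symm, npq'⟩

end IsInduced2P2

/-- `v` is `a`, `b`, or adjacent to `a` and `b` but not to `c` and `d`. -/
def OnSide {V : Type u} (H : SimpleGraph V) (a b c d v : V) : Prop :=
  v = a ∨ v = b ∨ (H.Adj v a ∧ H.Adj v b ∧ ¬ H.Adj v c ∧ ¬ H.Adj v d)

/-- `v` has a neighbour in `ab` and one in `cd`. -/
def TouchesBoth {V : Type u} (H : SimpleGraph V) (a b c d v : V) : Prop :=
  (H.Adj v a ∨ H.Adj v b) ∧ (H.Adj v c ∨ H.Adj v d)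

/-- `v` has no neighbour among `a b c d`. -/
def TouchesNone {V : Type u} (H : SimpleGraph V) (a b c d v : V) : Prop :=
  ¬ H.Adj v a ∧ ¬ H.Adj v b ∧ ¬ H.Adj v c ∧ ¬ H.Adj v d

namespace IsInduced2P2

variable {V : Type u} {H : SimpleGraph V} {a b c d : V}

/-- A vertex outside `ab` that touches `ab` but not `cd` sees both `a` and `b`: otherwise it forms
with `ab` an induced `P₃` missed by `cd`. -/
theorem cases (h : H.IsInduced2P2 a b c d) (hH : H.IsCoAtomLike) (v : V) :
    H.OnSide a b c d v ∨ H.OnSide c d a b v ∨ H.TouchesBoth a b c d v ∨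
      H.TouchesNone a b c d v := by
  by_cases ea : v = a
  · exact Or.inl (Or.inl ea)
  by_cases eb : v = b
  · exact Or.inl (Or.inr (Or.inl eb))
  by_cases ec : v = c
  · exact Or.inr (Or.inl (Or.inl ec))
  by_cases ed : v = d
  · exact Or.inr (Or.inl (Or.inr (Or.inl ed)))
  have h₁ := fun x y => h.not_adj_one hH (v := v) x eb y
  have h₂ := fun x y => h.flip_left.not_adj_one hH (v := v) x ea y
  have h₃ := fun x y => h.swap.not_adj_one hH (v := v) x ed y
  have h₄ := fun x y => h.swap.flip_left.not_adj_one hH (v := v) x ec y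
  unfold OnSide TouchesBoth TouchesNone
  by_cases va : H.Adj v a <;> by_cases vb : H.Adj v b <;> by_cases vc : H.Adj v c <;>
    by_cases vd : H.Adj v d <;> simp_all

theorem not_adj_of_onSide (h : H.IsInduced2P2 a b c d) {v : V} (hv : H.OnSide a b c d v) :
    ¬ H.Adj v c ∧ ¬ H.Adj v d := by
  rcases hv with rfl | rfl | hv
  · exact ⟨h.nac, h.nad⟩
  · exact ⟨h.nbc, h.nbd⟩
  · exact hv.2.2

theorem adj_of_onSide (h : H.IsInduced2P2 a b c d) (hH : H.IsCoAtomLike) {x y : V}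
    (hx : H.OnSide a b c d x) (hy : H.OnSide a b c d y) (hxy : x ≠ y) : H.Adj x y := by
  rcases hx with rfl | rfl | hx <;> rcases hy with rfl | rfl | hy
  · exact absurd rfl hxy
  · exact h.ab
  · exact hy.1.symm
  · exact h.ab.symm
  · exact absurd rfl hxy
  · exact hy.2.1.symm
  · exact hx.1
  · exact hx.2.1
  · by_contra hn
    exact hH.noP2P3 c d x a y h.cd hx.1 hy.1.symm hxy hn (fun k => hx.2.2.1 k.symm)
      (fun k => h.nac k.symm) (fun k => hy.2.2.1 k.symm) (fun k => hx.2.2.2 k.symm)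
      (fun k => h.nad k.symm) (fun k => hy.2.2.2 k.symm)

theorem touchesNone_swap {v : V} (hv : H.TouchesNone a b c d v) : H.TouchesNone c d a b v :=
  ⟨hv.2.2.1, hv.2.2.2, hv.1, hv.2.1⟩

theorem touchesBoth_swap {v : V} (hv : H.TouchesBoth a b c d v) : H.TouchesBoth c d a b v :=
  ⟨hv.2, hv.1⟩

theorem not_adj_of_touchesNone (h : H.IsInduced2P2 a b c d) (hH : H.IsCoAtomLike) {v x : V}
    (hv : H.TouchesNone a b c d v) (hx : H.OnSide a b c d x) : ¬ H.Adj v x := by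
  rcases hx with rfl | rfl | hx
  · exact hv.1
  · exact hv.2.1
  · intro hvx
    exact hH.noP2P3 c d v x a h.cd hvx hx.1 (fun k => hv.2.1 (k ▸ h.ab)) hv.1
      (fun k => hv.2.2.1 k.symm) (fun k => hx.2.2.1 k.symm) (fun k => h.nac k.symm)
      (fun k => hv.2.2.2 k.symm) (fun k => hx.2.2.2 k.symm) (fun k => h.nad k.symm)

theorem not_touchesBoth_of_onSide (h : H.IsInduced2P2 a b c d) {x : V}
    (hx : H.OnSide a b c d x) : ¬ H.TouchesBoth a b c d x := fun hx' =>
  hx'.2.elim (h.not_adj_of_onSide hx).1 (h.not_adj_of_onSide hx).2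

/-- A vertex `q` missing an edge of the side of `ab` is complete to the side of `cd`. -/
theorem complete_of_missed (h : H.IsInduced2P2 a b c d) (hH : H.IsCoAtomLike)
    (hC5 : ∀ x₀ x₁ x₂ x₃ x₄, ¬ H.IsInducedC5 x₀ x₁ x₂ x₃ x₄) {q u v a' c' : V}
    (hq : H.TouchesBoth a b c d q) (ha' : a' = a ∨ a' = b) (hc' : c' = c ∨ c' = d)
    (hqa' : H.Adj q a') (hqc' : H.Adj q c')
    (hu : H.OnSide a b c d u) (hv : H.OnSide a b c d v) (huv : H.Adj u v)
    (hqu : ¬ H.Adj q u) (hqv : ¬ H.Adj q v) :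
    (∀ y, H.OnSide c d a b y → H.Adj q y) ∧ ∀ i, H.TouchesNone a b c d i → ¬ H.Adj q i := by
  have ha'S : H.OnSide a b c d a' := ha'.elim Or.inl fun k => Or.inr (Or.inl k)
  have hc'S : H.OnSide c d a b c' := hc'.elim Or.inl fun k => Or.inr (Or.inl k)
  have nc' : ∀ x, H.OnSide a b c d x → ¬ H.Adj x c' := fun x hx => by
    rcases hc' with rfl | rfl
    · exact (h.not_adj_of_onSide hx).1
    · exact (h.not_adj_of_onSide hx).2
  have na' : ∀ x, H.OnSide c d a b x → ¬ H.Adj x a' := fun x hx => by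
    rcases ha' with rfl | rfl
    · exact (h.swap.not_adj_of_onSide hx).1
    · exact (h.swap.not_adj_of_onSide hx).2
  constructor
  · intro y hy
    by_contra hqy
    have hyc' : c' ≠ y := fun k => hqy (k ▸ hqc')
    have hyq : q ≠ y := fun k => na' y hy (k ▸ hqa')
    have hcy := h.swap.adj_of_onSide hH hc'S hy hyc'
    have key : ∀ x, H.OnSide a b c d x → ¬ H.Adj q x → ¬ H.Adj x y := by
      intro x hx hqx hxy
      have hax : a' ≠ x := fun k => hqx (k ▸ hqa')
      exact hC5 q a' x y c' ⟨hqa', h.adj_of_onSide hH ha'S hx hax, hxy, hcy.symm, hqc'.symm, hqx,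
        fun k => na' y hy k.symm, nc' x hx, fun k => hqy k.symm, fun k => nc' a' ha'S k.symm⟩
    exact hH.noP2P3 u v q c' y huv hqc' hcy hyq hqy (fun k => hqu k.symm) (nc' u hu)
      (key u hu hqu) (fun k => hqv k.symm) (nc' v hv) (key v hv hqv)
  · intro i hi hqi
    have hic' : ¬ H.Adj i c' := h.swap.not_adj_of_touchesNone hH (touchesNone_swap hi) hc'S
    have hic : i ≠ c' := by
      rintro rfl
      rcases hc' with rfl | rfl
      · exact hi.2.2.2 h.cd
      · exact hi.2.2.1 h.cd.symm
    exact hH.noP2P3 u v i q c' huv hqi.symm hqc' hic hic'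
      (fun k => h.not_adj_of_touchesNone hH hi hu k.symm) (fun k => hqu k.symm) (nc' u hu)
      (fun k => h.not_adj_of_touchesNone hH hi hv k.symm) (fun k => hqv k.symm) (nc' v hv)

/-- Consider an edge `uv` missed by `q`. No end touches both `ab` and `cd`, since such vertices form
a clique with `q`. Ends on different sides would close a `C₅` through `q`, and two ends touching
nothing would give `P₂ + P₃` with a path `a' q c'`. Hence `uv` lies within one side, and
`complete_of_missed` makes `q` complete to the other. -/
theorem complete_to_side (h : H.IsInduced2P2 a b c d) (hH : H.IsCoAtomLike)
    (hC5 : ∀ x₀ x₁ x₂ x₃ x₄, ¬ H.IsInducedC5 x₀ x₁ x₂ x₃ x₄)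
    (hQ : ∀ p q, H.TouchesBoth a b c d p → H.TouchesBoth a b c d q → p ≠ q → H.Adj p q) {q : V}
    (hq : H.TouchesBoth a b c d q) :
    ((∀ y, H.OnSide a b c d y → H.Adj q y) ∨ (∀ y, H.OnSide c d a b y → H.Adj q y)) ∧
      ∀ i, H.TouchesNone a b c d i → ¬ H.Adj q i := by
  obtain ⟨a', ha', hqa'⟩ : ∃ a', (a' = a ∨ a' = b) ∧ H.Adj q a' :=
    hq.1.elim (fun k => ⟨a, Or.inl rfl, k⟩) fun k => ⟨b, Or.inr rfl, k⟩
  obtain ⟨c', hc', hqc'⟩ : ∃ c', (c' = c ∨ c' = d) ∧ H.Adj q c' :=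
    hq.2.elim (fun k => ⟨c, Or.inl rfl, k⟩) fun k => ⟨d, Or.inr rfl, k⟩
  have ha'S : H.OnSide a b c d a' := ha'.elim Or.inl fun k => Or.inr (Or.inl k)
  have hc'S : H.OnSide c d a b c' := hc'.elim Or.inl fun k => Or.inr (Or.inl k)
  obtain ⟨u, v, huv, hqu, hqv⟩ := hH.exists_missed q a' hqa'
  have notQ : ∀ u v, H.Adj u v → ¬ H.Adj q u → ¬ H.Adj q v → ¬ H.TouchesBoth a b c d u := by
    intro u v huv hqu hqv hu
    by_cases e : q = u
    · exact hqv (e ▸ huv)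
    · exact hqu (hQ q u hq hu e)
  have cross : ∀ u v, H.Adj u v → ¬ H.Adj q u → ¬ H.Adj q v → H.OnSide a b c d u →
      H.OnSide c d a b v → False := by
    intro u v huv hqu hqv hu hv
    have hau : a' ≠ u := fun k => hqu (k ▸ hqa')
    have hcv : c' ≠ v := fun k => hqv (k ▸ hqc')
    have n₁ : ∀ x, H.OnSide a b c d x → ¬ H.Adj x c' := fun x hx => by
      rcases hc' with rfl | rfl
      · exact (h.not_adj_of_onSide hx).1
      · exact (h.not_adj_of_onSide hx).2
    have n₂ : ¬ H.Adj v a' := by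
      rcases ha' with rfl | rfl
      · exact (h.swap.not_adj_of_onSide hv).1
      · exact (h.swap.not_adj_of_onSide hv).2
    exact hC5 q a' u v c' ⟨hqa', h.adj_of_onSide hH ha'S hu hau, huv,
      (h.swap.adj_of_onSide hH hc'S hv hcv).symm, hqc'.symm, hqu, fun k => n₂ k.symm, n₁ u hu,
      fun k => hqv k.symm, fun k => n₁ a' ha'S k.symm⟩
  rcases h.cases hH u with hu | hu | hu | hu
  · rcases h.cases hH v with hv | hv | hv | hv
    · have := h.complete_of_missed hH hC5 hq ha' hc' hqa' hqc' hu hv huv hqu hqv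
      exact ⟨Or.inr this.1, this.2⟩
    · exact (cross u v huv hqu hqv hu hv).elim
    · exact (notQ v u huv.symm hqv hqu hv).elim
    · exact (h.not_adj_of_touchesNone hH hv hu huv.symm).elim
  · rcases h.cases hH v with hv | hv | hv | hv
    · exact (cross v u huv.symm hqv hqu hv hu).elim
    · have := h.swap.complete_of_missed hH hC5 (touchesBoth_swap hq) hc' ha' hqc' hqa' hu hv huv
        hqu hqv
      exact ⟨Or.inl this.1, fun i hi => this.2 i (touchesNone_swap hi)⟩
    · exact (notQ v u huv.symm hqv hqu hv).elim
    · exact (h.swap.not_adj_of_touchesNone hH (touchesNone_swap hv) hu huv.symm).elim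
  · exact (notQ u v huv hqu hqv hu).elim
  · rcases h.cases hH v with hv | hv | hv | hv
    · exact (h.not_adj_of_touchesNone hH hu hv huv).elim
    · exact (h.swap.not_adj_of_touchesNone hH (touchesNone_swap hu) hv huv).elim
    · exact (notQ v u huv.symm hqv hqu hv).elim
    · have hac : ¬ H.Adj a' c' := by
        rcases hc' with rfl | rfl
        · exact (h.not_adj_of_onSide ha'S).1
        · exact (h.not_adj_of_onSide ha'S).2
      have hne : a' ≠ c' := by
        intro k
        rcases hc' with rfl | rfl
        · exact (h.not_adj_of_onSide ha'S).2 (k ▸ h.cd)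
        · exact (h.not_adj_of_onSide ha'S).1 (k ▸ h.cd.symm)
      have n₁ := fun w (hw : H.TouchesNone a b c d w) => h.not_adj_of_touchesNone hH hw ha'S
      have n₂ := fun w (hw : H.TouchesNone a b c d w) =>
        h.swap.not_adj_of_touchesNone hH (touchesNone_swap hw) hc'S
      exact (hH.noP2P3 u v a' q c' huv hqa'.symm hqc' hne hac (n₁ u hu) (fun k => hqu k.symm)
        (n₂ u hu) (n₁ v hv) (fun k => hqv k.symm) (n₂ v hv)).elim

/-- The vertices touching none of `a b c d` are separated from the rest. If they span an edge, that
edge excludes an induced `P₃` elsewhere while `ab` excludes one among them, so `H` is a union of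
cliques. If not, they are isolated, and the others split into two cliques according to the side to
which they belong or are complete. -/
theorem cliqueWidth_compl_le_of_clique [Finite V] (h : H.IsInduced2P2 a b c d)
    (hH : H.IsCoAtomLike) (hC5 : ∀ x₀ x₁ x₂ x₃ x₄, ¬ H.IsInducedC5 x₀ x₁ x₂ x₃ x₄)
    (hQ : ∀ p q, H.TouchesBoth a b c d p → H.TouchesBoth a b c d q → p ≠ q → H.Adj p q) :
    Hᶜ.cliqueWidth ≤ 4 := by
  classical
  have hsep : ∀ i x, H.TouchesNone a b c d i → H.Adj i x → H.TouchesNone a b c d x := by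
    intro i x hi hix
    rcases h.cases hH x with hx | hx | hx | hx
    · exact (h.not_adj_of_touchesNone hH hi hx hix).elim
    · exact (h.swap.not_adj_of_touchesNone hH (touchesNone_swap hi) hx hix).elim
    · exact ((h.complete_to_side hH hC5 hQ hx).2 i hi hix.symm).elim
    · exact hx
  by_cases hI : ∃ i j, H.TouchesNone a b c d i ∧ H.Adj i j
  · obtain ⟨i, j, hi, hij⟩ := hI
    have hj := hsep i j hi hij
    refine (cliqueWidth_compl_le_of_transitive H ?_).trans (by norm_num)
    intro p q r hpq hqr hpr
    by_contra npr
    by_cases hq : H.TouchesNone a b c d q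
    · have hp := hsep q p hq hpq.symm
      have hr := hsep q r hq hqr
      exact hH.noP2P3 a b p q r h.ab hpq hqr hpr npr (fun k => hp.1 k.symm) (fun k => hq.1 k.symm)
        (fun k => hr.1 k.symm) (fun k => hp.2.1 k.symm) (fun k => hq.2.1 k.symm)
        (fun k => hr.2.1 k.symm)
    · have hp : ¬ H.TouchesNone a b c d p := fun hp => hq (hsep p q hp hpq)
      have hr : ¬ H.TouchesNone a b c d r := fun hr => hq (hsep r q hr hqr.symm)
      have n := fun x (hx : ¬ H.TouchesNone a b c d x) k => hx (hsep i x hi k)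
      have n' := fun x (hx : ¬ H.TouchesNone a b c d x) k => hx (hsep j x hj k)
      exact hH.noP2P3 i j p q r hij hpq hqr hpr npr (n p hp) (n q hq) (n r hr) (n' p hp) (n' q hq)
        (n' r hr)
  push Not at hI
  let K : V → Prop := fun v => H.OnSide a b c d v ∨
    (H.TouchesBoth a b c d v ∧ ∀ y, H.OnSide a b c d y → H.Adj v y)
  let L : V → Prop := fun v => H.OnSide c d a b v ∨
    (H.TouchesBoth a b c d v ∧ ∀ y, H.OnSide c d a b y → H.Adj v y)
  have hall : ∀ v, K v ∨ L v ∨ H.TouchesNone a b c d v := by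
    intro v
    rcases h.cases hH v with hv | hv | hv | hv
    · exact Or.inl (Or.inl hv)
    · exact Or.inr (Or.inl (Or.inl hv))
    · exact (h.complete_to_side hH hC5 hQ hv).1.elim (fun k => Or.inl (Or.inr ⟨hv, k⟩))
        fun k => Or.inr (Or.inl (Or.inr ⟨hv, k⟩))
    · exact Or.inr (Or.inr hv)
  have hK : ∀ x y, K x → K y → x ≠ y → H.Adj x y := by
    rintro x y (hx | hx) (hy | hy) hxy
    · exact h.adj_of_onSide hH hx hy hxy
    · exact (hy.2 x hx).symm
    · exact hx.2 y hy
    · exact hQ x y hx.1 hy.1 hxy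
  have hL : ∀ x y, L x → L y → x ≠ y → H.Adj x y := by
    rintro x y (hx | hx) (hy | hy) hxy
    · exact h.swap.adj_of_onSide hH hx hy hxy
    · exact (hy.2 x hx).symm
    · exact hx.2 y hy
    · exact hQ x y hx.1 hy.1 hxy
  refine cliqueWidth_compl_le_of_two_cliques hH
    (fun v => if K v then 0 else if L v then 1 else 2) ?_ ?_ ?_
  · intro x y hx hy
    refine hK x y ?_ ?_
    · by_contra hn
      by_cases hn' : L x <;> simp [hn, hn'] at hx
    · by_contra hn
      by_cases hn' : L y <;> simp [hn, hn'] at hy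
  · intro x y hx hy
    refine hL x y ?_ ?_
    · by_contra hn
      by_cases hn' : K x <;> simp [hn, hn'] at hx
    · by_contra hn
      by_cases hn' : K y <;> simp [hn, hn'] at hy
  · intro x y hx
    refine hI x y ?_
    rcases hall x with k | k | k
    · simp [k] at hx
    · by_cases hn' : K x <;> simp [k, hn'] at hx
    · exact k

end IsInduced2P2

/-! ### An induced `C₆` and no induced `C₅`. -/

/-- `a p c d q b` is an induced cycle of `H` on six vertices. -/
structure IsInducedC6 {V : Type u} (H : SimpleGraph V) (a b c d p q : V) : Prop
    extends H.IsInduced2P2 a b c d where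
  pa : H.Adj p a
  pc : H.Adj p c
  npb : ¬ H.Adj p b
  npd : ¬ H.Adj p d
  qb : H.Adj q b
  qd : H.Adj q d
  nqa : ¬ H.Adj q a
  nqc : ¬ H.Adj q c
  npq : ¬ H.Adj p q

namespace IsInducedC6

variable {V : Type u} {H : SimpleGraph V} {a b c d p q : V}

theorem swap (h : H.IsInducedC6 a b c d p q) : H.IsInducedC6 c d a b p q :=
  ⟨h.toIsInduced2P2.swap, h.pc, h.pa, h.npd, h.npb, h.qd, h.qb, h.nqc, h.nqa, h.npq⟩

theorem flip (h : H.IsInducedC6 a b c d p q) : H.IsInducedC6 b a d c q p :=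
  ⟨h.toIsInduced2P2.flip_left.flip_right, h.qb, h.qd, h.nqa, h.nqc, h.pa, h.pc, h.npb, h.npd,
    fun k => h.npq k.symm⟩

theorem no_extra_onSide (h : H.IsInducedC6 a b c d p q) (hH : H.IsCoAtomLike)
    (hC5 : ∀ x₀ x₁ x₂ x₃ x₄, ¬ H.IsInducedC5 x₀ x₁ x₂ x₃ x₄) {x : V}
    (hx : H.OnSide a b c d x) : x = a ∨ x = b := by
  rcases hx with hx | hx | ⟨xa, xb, nxc, nxd⟩
  · exact Or.inl hx
  · exact Or.inr hx
  exfalso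
  have hpd : p ≠ d := fun k => h.nad (k ▸ h.pa.symm)
  have hqc : q ≠ c := fun k => h.nbc (k ▸ h.qb.symm)
  by_cases hxp : H.Adj x p
  · by_cases hxq : H.Adj x q
    · exact hC5 p x q d c ⟨hxp.symm, hxq, h.qd, h.cd.symm, h.pc.symm, h.npq, nxd, h.nqc,
        fun k => h.npd k.symm, fun k => nxc k.symm⟩
    · exact hH.noP2P3 x a q d c xa h.qd h.cd.symm hqc h.nqc hxq nxd nxc (fun k => h.nqa k.symm)
        h.nad h.nac
  · exact hH.noP2P3 x b p c d xb h.pc h.cd hpd h.npd hxp nxc nxd (fun k => h.npb k.symm) h.nbc h.nbd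

/-- Among `a b c d`, the neighbours of `v` are those of `p`. -/
def HasLeftType (H : SimpleGraph V) (a b c d v : V) : Prop :=
  H.Adj v a ∧ H.Adj v c ∧ ¬ H.Adj v b ∧ ¬ H.Adj v d

theorem no_common_of_2P2 (h : H.IsInduced2P2 a b c d) (hH : H.IsCoAtomLike)
    (hC5 : ∀ x₀ x₁ x₂ x₃ x₄, ¬ H.IsInducedC5 x₀ x₁ x₂ x₃ x₄) {p q : V} (hpq : p ≠ q)
    (npq : ¬ H.Adj p q) (hp : H.TouchesBoth a b c d p) (hq : H.TouchesBoth a b c d q) :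
    (¬ H.Adj p a ∨ ¬ H.Adj q a) ∧ (¬ H.Adj p b ∨ ¬ H.Adj q b) ∧
    (¬ H.Adj p c ∨ ¬ H.Adj q c) ∧ (¬ H.Adj p d ∨ ¬ H.Adj q d) := by
  refine ⟨?_, ?_, ?_, ?_⟩ <;> rw [← not_and_or] <;> rintro ⟨k₁, k₂⟩
  · exact h.no_common_left hH hC5 hpq npq hp.2 hq.2 k₁ k₂
  · exact h.flip_left.no_common_left hH hC5 hpq npq hp.2 hq.2 k₁ k₂
  · exact h.swap.no_common_left hH hC5 hpq npq hp.1 hq.1 k₁ k₂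
  · exact h.swap.flip_left.no_common_left hH hC5 hpq npq hp.1 hq.1 k₁ k₂

theorem touchesBoth_left (h : H.IsInducedC6 a b c d p q) : H.TouchesBoth a b c d p :=
  ⟨Or.inl h.pa, Or.inl h.pc⟩

theorem touchesBoth_right (h : H.IsInducedC6 a b c d p q) : H.TouchesBoth a b c d q :=
  ⟨Or.inr h.qb, Or.inr h.qd⟩

/-- The absence of `C₄` would make `r` complete to `a b c d`. An edge missed by `r` then has both
ends in `TouchesNone`, since a vertex touching both sides but not adjacent to `r` may share no
neighbour with it there. That edge and `a r c` form `P₂ + P₃`. -/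
theorem not_adj_both (h : H.IsInducedC6 a b c d p q) (hH : H.IsCoAtomLike)
    (hC5 : ∀ x₀ x₁ x₂ x₃ x₄, ¬ H.IsInducedC5 x₀ x₁ x₂ x₃ x₄) {r : V}
    (hr : H.TouchesBoth a b c d r) (hrp : H.Adj r p) (hrq : H.Adj r q) : False := by
  have hpb : p ≠ b := fun k => h.nbc (k ▸ h.pc)
  have hpd : p ≠ d := fun k => h.nad (k ▸ h.pa.symm)
  have hqa : q ≠ a := fun k => h.nad (k ▸ h.qd)
  have hqc : q ≠ c := fun k => h.nbc (k ▸ h.qb.symm)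
  have hne : ∀ x, ¬ H.TouchesBoth a b c d x → r ≠ x := fun x hx k => hx (k ▸ hr)
  have hra' : r ≠ a := hne a (h.not_touchesBoth_of_onSide (Or.inl rfl))
  have hrb' : r ≠ b := hne b (h.not_touchesBoth_of_onSide (Or.inr (Or.inl rfl)))
  have hrc' : r ≠ c := hne c fun k => h.toIsInduced2P2.swap.not_touchesBoth_of_onSide (Or.inl rfl)
    (IsInduced2P2.touchesBoth_swap k)
  have hrd' : r ≠ d := hne d fun k => h.toIsInduced2P2.swap.not_touchesBoth_of_onSide
    (Or.inr (Or.inl rfl)) (IsInduced2P2.touchesBoth_swap k)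
  have ra : H.Adj r a := by
    by_contra k
    exact hH.noC4 r b a p (hr.1.resolve_left k) h.ab.symm h.pa.symm hrp.symm hra' hpb.symm k
      (fun k => h.npb k.symm)
  have rc : H.Adj r c := by
    by_contra k
    exact hH.noC4 r d c p (hr.2.resolve_left k) h.cd.symm h.pc.symm hrp.symm hrc' hpd.symm k
      (fun k => h.npd k.symm)
  have rb : H.Adj r b := by
    by_contra k
    exact hH.noC4 r a b q ra h.ab h.qb.symm hrq.symm hrb' hqa.symm k (fun k => h.nqa k.symm)
  have rd : H.Adj r d := by
    by_contra k
    exact hH.noC4 r c d q rc h.cd h.qd.symm hrq.symm hrd' hqc.symm k (fun k => h.nqc k.symm)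
  obtain ⟨u, v, huv, hru, hrv⟩ := hH.exists_missed r a ra
  have key : ∀ u v, H.Adj u v → ¬ H.Adj r u → ¬ H.Adj r v → H.TouchesNone a b c d u := by
    intro u v huv hru hrv
    rcases h.cases hH u with hu | hu | hu | hu
    · rcases h.no_extra_onSide hH hC5 hu with rfl | rfl
      · exact absurd ra hru
      · exact absurd rb hru
    · rcases h.swap.no_extra_onSide hH hC5 hu with rfl | rfl
      · exact absurd rc hru
      · exact absurd rd hru
    · have e : r ≠ u := fun k => hrv (k ▸ huv)
      have := no_common_of_2P2 h.toIsInduced2P2 hH hC5 e hru hr hu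
      rcases hu.1 with k | k
      · exact absurd k (this.1.resolve_left fun k => k ra)
      · exact absurd k (this.2.1.resolve_left fun k => k rb)
    · exact hu
  have hu := key u v huv hru hrv
  have hv := key v u huv.symm hrv hru
  have hac : a ≠ c := fun k => h.nad (k ▸ h.cd)
  exact hH.noP2P3 u v a r c huv ra.symm rc hac h.nac hu.1 (fun k => hru k.symm) hu.2.2.1 hv.1
    (fun k => hrv k.symm) hv.2.2.1

/-- A vertex touching both edges is non-adjacent to `p` or to `q`. Having no common neighbour with
that vertex among `a b c d`, it has the trace of the other. -/
theorem type_cases (h : H.IsInducedC6 a b c d p q) (hH : H.IsCoAtomLike)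
    (hC5 : ∀ x₀ x₁ x₂ x₃ x₄, ¬ H.IsInducedC5 x₀ x₁ x₂ x₃ x₄) {v : V}
    (hv : v ≠ a ∧ v ≠ b ∧ v ≠ c ∧ v ≠ d) :
    HasLeftType H a b c d v ∨ HasLeftType H b a d c v ∨ H.TouchesNone a b c d v := by
  rcases h.cases hH v with k | k | k | k
  · exact absurd (h.no_extra_onSide hH hC5 k) (by tauto)
  · exact absurd (h.swap.no_extra_onSide hH hC5 k) (by tauto)
  · by_cases ep : v = p
    · subst ep
      exact Or.inl ⟨h.pa, h.pc, h.npb, h.npd⟩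
    by_cases eq : v = q
    · subst eq
      exact Or.inr (Or.inl ⟨h.qb, h.qd, h.nqa, h.nqc⟩)
    by_cases hvp : H.Adj v p
    · have hvq : ¬ H.Adj v q := h.not_adj_both hH hC5 k hvp
      have := no_common_of_2P2 h.toIsInduced2P2 hH hC5 eq hvq k h.touchesBoth_right
      have nb : ¬ H.Adj v b := this.2.1.resolve_right fun k => k h.qb
      have nd : ¬ H.Adj v d := this.2.2.2.resolve_right fun k => k h.qd
      exact Or.inl ⟨k.1.resolve_right nb, k.2.resolve_right nd, nb, nd⟩
    · have := no_common_of_2P2 h.toIsInduced2P2 hH hC5 ep hvp k h.touchesBoth_left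
      have na : ¬ H.Adj v a := this.1.resolve_right fun k => k h.pa
      have nc : ¬ H.Adj v c := this.2.2.1.resolve_right fun k => k h.pc
      exact Or.inr (Or.inl ⟨k.1.resolve_left na, k.2.resolve_left nc, na, nc⟩)
  · exact Or.inr (Or.inr k)

theorem adj_of_type (h : H.IsInducedC6 a b c d p q) (hH : H.IsCoAtomLike) {x y : V}
    (hx : HasLeftType H a b c d x) (hy : HasLeftType H a b c d y) (hxy : x ≠ y) : H.Adj x y := by
  by_contra k
  exact hH.noC4 x a y c hx.1 hy.1.symm hy.2.1 hx.2.1.symm hxy (fun k => h.nad (k ▸ h.cd)) k h.nac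

theorem not_adj_of_types (h : H.IsInducedC6 a b c d p q) (hH : H.IsCoAtomLike) {x y : V}
    (hx : HasLeftType H a b c d x) (hy : HasLeftType H b a d c y) : ¬ H.Adj x y := fun k =>
  hH.noC4 x a b y hx.1 h.ab hy.1.symm k.symm (fun k => h.nbc (k ▸ hx.2.1))
    (fun k => h.nad (k ▸ hy.2.1)) hx.2.2.1 (fun k => hy.2.2.1 k.symm)

theorem not_adj_both_none (h : H.IsInducedC6 a b c d p q)
    (hC5 : ∀ x₀ x₁ x₂ x₃ x₄, ¬ H.IsInducedC5 x₀ x₁ x₂ x₃ x₄) {i x y : V}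
    (hi : H.TouchesNone a b c d i) (hx : HasLeftType H a b c d x) (hy : HasLeftType H b a d c y)
    (hxy : ¬ H.Adj x y) (hix : H.Adj i x) (hiy : H.Adj i y) : False :=
  hC5 x i y b a ⟨hix.symm, hiy, hy.1, h.ab.symm, hx.1.symm, hxy, hi.2.1, hy.2.2.1,
    fun k => hx.2.2.1 k.symm, fun k => hi.1 k.symm⟩

theorem adj_none_iff (h : H.IsInducedC6 a b c d p q) (hH : H.IsCoAtomLike)
    (hC5 : ∀ x₀ x₁ x₂ x₃ x₄, ¬ H.IsInducedC5 x₀ x₁ x₂ x₃ x₄) {i x y : V}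
    (hi : H.TouchesNone a b c d i) (hx : HasLeftType H a b c d x) (hy : HasLeftType H a b c d y)
    (hix : H.Adj i x) : H.Adj i y := by
  by_contra hiy
  have hxy : x ≠ y := fun k => hiy (k ▸ hix)
  have hq : HasLeftType H b a d c q := ⟨h.qb, h.qd, h.nqa, h.nqc⟩
  have hne : i ≠ y := fun k => hi.1 (k ▸ hy.1)
  exact hH.noP2P3 q b i x y h.qb hix (h.adj_of_type hH hx hy hxy) hne hiy
    (fun k => h.not_adj_both_none hC5 hi hx hq (h.not_adj_of_types hH hx hq) hix k.symm)
    (fun k => h.not_adj_of_types hH hx hq k.symm) (fun k => h.not_adj_of_types hH hy hq k.symm)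
    (fun k => hi.2.1 k.symm) (fun k => hx.2.2.1 k.symm) (fun k => hy.2.2.1 k.symm)

/-- The vertices touching none of `a b c d` form disjoint cliques because of `ab`. An edge among
them with both ends or no end adjacent to `p` yields `P₂ + P₃` with `b q d` or `a p c`; so these
cliques have at most two vertices, told apart by adjacency to `p`. The constant is `6 + 2 ^ 6 + 2 +
1`. -/
theorem cliqueWidth_compl_le [Finite V] (h : H.IsInducedC6 a b c d p q) (hH : H.IsCoAtomLike)
    (hC5 : ∀ x₀ x₁ x₂ x₃ x₄, ¬ H.IsInducedC5 x₀ x₁ x₂ x₃ x₄) :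
    Hᶜ.cliqueWidth ≤ 73 := by
  classical
  have hp : HasLeftType H a b c d p := ⟨h.pa, h.pc, h.npb, h.npd⟩
  have hq : HasLeftType H b a d c q := ⟨h.qb, h.qd, h.nqa, h.nqc⟩
  have hnone : ∀ {v}, H.TouchesNone a b c d v → H.TouchesNone b a d c v := fun k =>
    ⟨k.2.1, k.1, k.2.2.2, k.2.2.1⟩
  have hiP : ∀ i x, H.TouchesNone a b c d i → HasLeftType H a b c d x → (H.Adj i x ↔ H.Adj i p) :=
    fun i x hi hx => ⟨h.adj_none_iff hH hC5 hi hx hp, h.adj_none_iff hH hC5 hi hp hx⟩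
  have hiQ : ∀ i x, H.TouchesNone a b c d i → HasLeftType H b a d c x → (H.Adj i x ↔ H.Adj i q) :=
    fun i x hi hx => ⟨h.flip.adj_none_iff hH hC5 (hnone hi) hx hq,
      h.flip.adj_none_iff hH hC5 (hnone hi) hq hx⟩
  have hcl := fun v (hv : v ∉ ({a, b, c, d, p, q} : Finset V)) =>
    h.type_cases hH hC5 (v := v) (by simp at hv; tauto)
  have := cliqueWidth_compl_le_of_small_classes H (s := 6) (m := 2) {a, b, c, d, p, q}
    Finset.card_le_six
    (fun u v => H.TouchesNone a b c d u ∧ H.TouchesNone a b c d v ∧ (u = v ∨ H.Adj u v))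
    (fun u v _ _ k => ⟨k.2.1, k.1, k.2.2.imp Eq.symm (·.symm)⟩) ?_
    (fun v => if H.Adj v p then 0 else 1) ?_ ?_
  · exact this
  · rintro u v w _ _ _ ⟨hu, hv, h₁⟩ ⟨_, hw, h₂⟩
    refine ⟨hu, hw, ?_⟩
    rcases h₁ with rfl | h₁
    · exact h₂
    rcases h₂ with rfl | h₂
    · exact Or.inr h₁
    by_cases huw : u = w
    · exact Or.inl huw
    refine Or.inr ?_
    by_contra k
    exact hH.noP2P3 a b u v w h.ab h₁ h₂ huw k (fun k => hu.1 k.symm) (fun k => hv.1 k.symm)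
        (fun k => hw.1 k.symm) (fun k => hu.2.1 k.symm) (fun k => hv.2.1 k.symm)
        (fun k => hw.2.1 k.symm)
  · rintro u v _ _ ⟨hu, hv, h₁⟩ hslot
    refine h₁.resolve_right fun huv => ?_
    by_cases hup : H.Adj u p <;> by_cases hvp : H.Adj v p
    · have hbd : b ≠ d := fun k => h.nbc (k ▸ h.cd.symm)
      have n := fun i hi => h.not_adj_both_none hC5 (i := i) hi hp hq h.npq
      exact hH.noP2P3 u v b q d huv h.qb.symm h.qd hbd h.nbd hu.2.1 (n u hu hup) hu.2.2.2 hv.2.1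
        (n v hv hvp) hv.2.2.2
    · simp [hup, hvp] at hslot
    · simp [hup, hvp] at hslot
    · have hac : a ≠ c := fun k => h.nad (k ▸ h.cd)
      exact hH.noP2P3 u v a p c huv h.pa.symm h.pc hac h.nac hu.1 hup hu.2.2.1 hv.1 hvp hv.2.2.1
  -- Adjacency to `a` and `b` reveals the kind of a vertex, and a vertex touching none treats a
  -- whole type as it treats `p` or `q`. Thus traces on the hexagon decide all adjacencies between
  -- different classes.
  · have key : ∀ u v, u ∉ ({a, b, c, d, p, q} : Finset V) → v ∉ ({a, b, c, d, p, q} : Finset V) →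
        u ≠ v → ¬ (H.TouchesNone a b c d u ∧ H.TouchesNone a b c d v ∧ (u = v ∨ H.Adj u v)) →
        (H.Adj u v ↔ (H.Adj u a ∧ H.Adj v a) ∨ (H.Adj u b ∧ H.Adj v b) ∨
          (¬ H.Adj u a ∧ ¬ H.Adj u b ∧ (H.Adj v a ∧ H.Adj u p ∨ H.Adj v b ∧ H.Adj u q)) ∨
          (¬ H.Adj v a ∧ ¬ H.Adj v b ∧ (H.Adj u a ∧ H.Adj v p ∨ H.Adj u b ∧ H.Adj v q))) := by
      intro u v hu hv huv hr
      rcases hcl u hu with k | k | k <;> rcases hcl v hv with l | l | l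
      · simp [k.1, l.1, h.adj_of_type hH k l huv]
      · simp [k.1, k.2.2.1, l.1, l.2.2.1, h.not_adj_of_types hH k l]
      · simp [k.1, k.2.2.1, l.1, l.2.1, H.adj_comm u v, hiP v u l k]
      · simp [k.1, k.2.2.1, l.1, l.2.2.1, H.adj_comm u v, h.not_adj_of_types hH l k]
      · simp [k.1, l.1, h.flip.adj_of_type hH k l huv]
      · simp [k.1, k.2.2.1, l.1, l.2.1, H.adj_comm u v, hiQ v u l k]
      · simp [l.1, l.2.2.1, k.1, k.2.1, hiP u v k l]
      · simp [l.1, l.2.2.1, k.1, k.2.1, hiQ u v k l]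
      · have : ¬ H.Adj u v := fun m => hr ⟨k, l, Or.inr m⟩
        simp [k.1, k.2.1, l.1, l.2.1, this]
    intro u v u' v' hu hv hu' hv' huv huv' hr hr' h₁ h₂ hadj
    rw [key u' v' hu' hv' huv' hr']
    rw [key u v hu hv huv hr] at hadj
    rwa [h₁ a (by simp), h₁ b (by simp), h₁ p (by simp), h₁ q (by simp), h₂ a (by simp),
      h₂ b (by simp), h₂ p (by simp), h₂ q (by simp)] at hadj

end IsInducedC6

theorem IsInduced2P2.cliqueWidth_compl_le {V : Type u} [Finite V] {H : SimpleGraph V} {a b c d : V}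
    (h : H.IsInduced2P2 a b c d) (hH : H.IsCoAtomLike)
    (hC5 : ∀ x₀ x₁ x₂ x₃ x₄, ¬ H.IsInducedC5 x₀ x₁ x₂ x₃ x₄) : Hᶜ.cliqueWidth ≤ 73 := by
  by_cases hQ : ∀ p q, H.TouchesBoth a b c d p → H.TouchesBoth a b c d q → p ≠ q → H.Adj p q
  · exact (h.cliqueWidth_compl_le_of_clique hH hC5 hQ).trans (by norm_num)
  push Not at hQ
  obtain ⟨p, q, hp, hq, hpq, npq⟩ := hQ
  obtain ⟨ka, kb, kc, kd⟩ := IsInducedC6.no_common_of_2P2 h hH hC5 hpq npq hp hq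
  have npq' : ¬ H.Adj q p := fun k => npq k.symm
  obtain ⟨hp₁, hp₂⟩ := hp
  obtain ⟨hq₁, hq₂⟩ := hq
  by_cases pa : H.Adj p a
  · have nqa : ¬ H.Adj q a := ka.resolve_left fun k => k pa
    have qb : H.Adj q b := hq₁.resolve_left nqa
    have npb : ¬ H.Adj p b := kb.resolve_right fun k => k qb
    by_cases pc : H.Adj p c
    · have nqc : ¬ H.Adj q c := kc.resolve_left fun k => k pc
      have qd : H.Adj q d := hq₂.resolve_left nqc
      have npd : ¬ H.Adj p d := kd.resolve_right fun k => k qd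
      exact IsInducedC6.cliqueWidth_compl_le ⟨h, pa, pc, npb, npd, qb, qd, nqa, nqc, npq⟩ hH hC5
    · have pd : H.Adj p d := hp₂.resolve_left pc
      have nqd : ¬ H.Adj q d := kd.resolve_left fun k => k pd
      have qc : H.Adj q c := hq₂.resolve_right nqd
      exact IsInducedC6.cliqueWidth_compl_le ⟨h.flip_right, pa, pd, npb, pc, qb, qc, nqa, nqd, npq⟩
        hH hC5
  · have pb : H.Adj p b := hp₁.resolve_left pa
    have nqb : ¬ H.Adj q b := kb.resolve_left fun k => k pb
    have qa : H.Adj q a := hq₁.resolve_right nqb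
    by_cases pc : H.Adj p c
    · have nqc : ¬ H.Adj q c := kc.resolve_left fun k => k pc
      have qd : H.Adj q d := hq₂.resolve_left nqc
      have npd : ¬ H.Adj p d := kd.resolve_right fun k => k qd
      exact IsInducedC6.cliqueWidth_compl_le ⟨h.flip_left, pb, pc, pa, npd, qa, qd, nqb, nqc, npq⟩
        hH hC5
    · have pd : H.Adj p d := hp₂.resolve_left pc
      have nqd : ¬ H.Adj q d := kd.resolve_left fun k => k pd
      have qc : H.Adj q c := hq₂.resolve_right nqd
      exact IsInducedC6.cliqueWidth_compl_le
        ⟨h.flip_left.flip_right, pb, pd, pa, pc, qa, qc, nqb, nqd, npq⟩ hH hC5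

/-! ### Vertices adjacent to three consecutive vertices of a `C₅`. -/

/-- `v` is adjacent to exactly `x₄ x₀ x₁` on the cycle `x₀ x₁ x₂ x₃ x₄`. -/
def IsNear {V : Type u} (H : SimpleGraph V) (x₀ x₁ x₂ x₃ x₄ v : V) : Prop :=
  H.Adj v x₄ ∧ H.Adj v x₀ ∧ H.Adj v x₁ ∧ ¬ H.Adj v x₂ ∧ ¬ H.Adj v x₃

namespace IsInducedC5

variable {V : Type u} {H : SimpleGraph V} {x₀ x₁ x₂ x₃ x₄ : V}

theorem rotate (h : H.IsInducedC5 x₀ x₁ x₂ x₃ x₄) : H.IsInducedC5 x₁ x₂ x₃ x₄ x₀ :=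
  ⟨h.a₁₂, h.a₂₃, h.a₃₄, h.a₄₀, h.a₀₁, h.n₁₃, h.n₂₄, h.n₃₀, h.n₄₁, h.n₀₂⟩

theorem reflect (h : H.IsInducedC5 x₀ x₁ x₂ x₃ x₄) : H.IsInducedC5 x₀ x₄ x₃ x₂ x₁ :=
  ⟨h.a₄₀.symm, h.a₃₄.symm, h.a₂₃.symm, h.a₁₂.symm, h.a₀₁.symm, fun k => h.n₃₀ k.symm,
    fun k => h.n₂₄ k.symm, fun k => h.n₁₃ k.symm, fun k => h.n₀₂ k.symm, fun k => h.n₄₁ k.symm⟩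

theorem ne₀₂ (h : H.IsInducedC5 x₀ x₁ x₂ x₃ x₄) : x₀ ≠ x₂ := fun k => h.n₃₀ (k ▸ h.a₂₃.symm)

theorem adj_middle (h : H.IsInducedC5 x₀ x₁ x₂ x₃ x₄) (hH : H.IsCoAtomLike) {v : V} (hv : v ≠ x₁)
    (h₀ : H.Adj v x₀) (h₂ : H.Adj v x₂) : H.Adj v x₁ := by
  by_contra k
  exact hH.noC4 x₀ v x₂ x₁ h₀.symm h₂ h.a₁₂.symm h.a₀₁.symm h.ne₀₂ hv h.n₀₂ k

theorem adj_of_common (h : H.IsInducedC5 x₀ x₁ x₂ x₃ x₄) (hH : H.IsCoAtomLike) {u v : V}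
    (huv : u ≠ v) (hu₀ : H.Adj u x₀) (hu₂ : H.Adj u x₂) (hv₀ : H.Adj v x₀) (hv₂ : H.Adj v x₂) :
    H.Adj u v := by
  by_contra k
  exact hH.noC4 u x₀ v x₂ hu₀ hv₀.symm hv₂ hu₂.symm huv h.ne₀₂ k h.n₀₂

theorem isNear_reflect {v : V} (hv : H.IsNear x₀ x₁ x₂ x₃ x₄ v) : H.IsNear x₀ x₄ x₃ x₂ x₁ v :=
  ⟨hv.2.2.1, hv.2.1, hv.1, hv.2.2.2.2, hv.2.2.2.1⟩

theorem not_adj_near (h : H.IsInducedC5 x₀ x₁ x₂ x₃ x₄) (hH : H.IsCoAtomLike) {u v : V}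
    (hu : H.IsNear x₀ x₁ x₂ x₃ x₄ u) (hv : v ≠ x₁) (hv₂ : H.Adj v x₂) (hv₁ : ¬ H.Adj v x₁) :
    ¬ H.Adj u v := fun k =>
  hH.noC4 u v x₂ x₁ k hv₂ h.a₁₂.symm hu.2.2.1.symm (fun e => hu.2.2.2.2 (e ▸ h.a₂₃)) hv hu.2.2.2.1
    hv₁

theorem adj_near (h : H.IsInducedC5 x₀ x₁ x₂ x₃ x₄) (hH : H.IsCoAtomLike) {u v : V}
    (hu : H.IsNear x₀ x₁ x₂ x₃ x₄ u) (hv : v ≠ x₃) (hv₂ : H.Adj v x₂) (hv₃ : ¬ H.Adj v x₃)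
    (hv₀ : ¬ H.Adj v x₀) : H.Adj u v := by
  by_contra k
  exact hH.noP2P3 u x₀ v x₂ x₃ hu.2.1 hv₂ h.a₂₃ hv hv₃ k hu.2.2.2.1 hu.2.2.2.2
    (fun k => hv₀ k.symm) h.n₀₂ (fun k => h.n₃₀ k.symm)

/-- Up to one exceptional pair, the vertices of type `x₄ x₀ x₁` are adjacent to the vertices of
type `x₀ x₁ x₂`. -/
theorem near_exceptional (h : H.IsInducedC5 x₀ x₁ x₂ x₃ x₄) (hH : H.IsCoAtomLike) {u v u' v' : V}
    (hu : H.IsNear x₀ x₁ x₂ x₃ x₄ u) (hv : H.IsNear x₁ x₂ x₃ x₄ x₀ v) (huv : ¬ H.Adj u v)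
    (hu' : H.IsNear x₀ x₁ x₂ x₃ x₄ u') (hv' : H.IsNear x₁ x₂ x₃ x₄ x₀ v') (huv' : ¬ H.Adj u' v') :
    u = u' ∧ v = v' := by
  have hU : ∀ u u' v, H.IsNear x₀ x₁ x₂ x₃ x₄ u → H.IsNear x₀ x₁ x₂ x₃ x₄ u' →
      H.IsNear x₁ x₂ x₃ x₄ x₀ v → ¬ H.Adj u v → ¬ H.Adj u' v → u = u' := by
    intro u u' v hu hu' hv huv huv'
    by_contra e
    have := h.rotate.rotate.rotate.rotate.adj_of_common hH e hu.1 hu.2.2.1 hu'.1 hu'.2.2.1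
    exact hH.noP2P3 u u' v x₂ x₃ this hv.2.2.1 h.a₂₃ (fun e => hv.2.2.2.2 (e ▸ h.a₃₄))
      hv.2.2.2.1 huv hu.2.2.2.1 hu.2.2.2.2 huv' hu'.2.2.2.1 hu'.2.2.2.2
  have hV : ∀ u v v', H.IsNear x₀ x₁ x₂ x₃ x₄ u → H.IsNear x₁ x₂ x₃ x₄ x₀ v →
      H.IsNear x₁ x₂ x₃ x₄ x₀ v' → ¬ H.Adj u v → ¬ H.Adj u v' → v = v' := by
    intro u v v' hu hv hv' huv huv'
    by_contra e
    have := h.adj_of_common hH e hv.1 hv.2.2.1 hv'.1 hv'.2.2.1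
    exact hH.noP2P3 v v' u x₄ x₃ this hu.1 h.a₃₄.symm (fun e => hu.2.2.2.1 (e ▸ h.a₂₃.symm))
      hu.2.2.2.2 (fun k => huv k.symm) hv.2.2.2.2 hv.2.2.2.1 (fun k => huv' k.symm) hv'.2.2.2.2
      hv'.2.2.2.1
  by_cases e : u = u'
  · subst e
    exact ⟨rfl, hV u v v' hu hv hv' huv huv'⟩
  by_cases e' : v = v'
  · subst e'
    exact absurd (hU u u' v hu hu' hv huv huv') e
  have h₁ : H.Adj u v' := by
    by_contra k
    exact e' (hV u v v' hu hv hv' huv k)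
  have h₂ : H.Adj u' v := by
    by_contra k
    exact e' (hV u' v v' hu' hv hv' k huv')
  -- Two disjoint exceptional pairs would span an induced `C₄`.
  have h₃ := h.rotate.rotate.rotate.rotate.adj_of_common hH e hu.1 hu.2.2.1 hu'.1 hu'.2.2.1
  have h₄ := h.adj_of_common hH e' hv.1 hv.2.2.1 hv'.1 hv'.2.2.1
  exact (hH.noC4 u u' v v' h₃ h₂ h₄ h₁.symm (fun e => hv.2.2.2.2 (e ▸ hu.1))
    (fun e => hv'.2.2.2.2 (e ▸ hu'.1)) huv huv').elim

/-- Apart from the exceptional pairs, the trace of `v` on the cycle forces the answer: the wrong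
choice always creates a `C₄` or a `P₂ + P₃`. The proof checks all 32 traces; impossible ones are
refuted. -/
theorem adj_near_iff (h : H.IsInducedC5 x₀ x₁ x₂ x₃ x₄) (hH : H.IsCoAtomLike) {u v : V}
    (hu : H.IsNear x₀ x₁ x₂ x₃ x₄ u) (huv : u ≠ v)
    (hv : v ≠ x₀ ∧ v ≠ x₁ ∧ v ≠ x₂ ∧ v ≠ x₃ ∧ v ≠ x₄)
    (hv₁ : H.IsNear x₁ x₂ x₃ x₄ x₀ v → H.Adj u v) (hv₄ : H.IsNear x₄ x₀ x₁ x₂ x₃ v → H.Adj u v) :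
    H.Adj u v ↔ H.Adj v x₀ ∨ (H.Adj v x₁ ∧ H.Adj v x₂ ∧ ¬ H.Adj v x₃) ∨
      (H.Adj v x₄ ∧ H.Adj v x₃ ∧ ¬ H.Adj v x₂) := by
  have c₀ := h.rotate.rotate.rotate.rotate.adj_middle hH hv.1
  have c₁ := h.adj_middle hH hv.2.1
  have c₂ := h.rotate.adj_middle hH hv.2.2.1
  have c₃ := h.rotate.rotate.adj_middle hH hv.2.2.2.1
  have c₄ := h.rotate.rotate.rotate.adj_middle hH hv.2.2.2.2
  have hR₁ : ¬ H.Adj v x₂ → ¬ H.Adj v x₃ → H.Adj u v → H.Adj v x₀ := by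
    intro n₂ n₃ k
    by_contra k'
    exact hH.noP2P3 x₂ x₃ v u x₀ h.a₂₃ k.symm hu.2.1 hv.1 k' (fun k => n₂ k.symm)
      (fun k => hu.2.2.2.1 k.symm) (fun k => h.n₀₂ k.symm) (fun k => n₃ k.symm)
      (fun k => hu.2.2.2.2 k.symm) h.n₃₀
  have hR₂ : ¬ H.Adj v x₂ → ¬ H.Adj v x₃ → H.Adj v x₀ → H.Adj u v := by
    intro n₂ n₃ k
    by_contra k'
    exact hH.noP2P3 x₂ x₃ v x₀ u h.a₂₃ k hu.2.1.symm huv.symm (fun k => k' k.symm)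
      (fun k => n₂ k.symm) (fun k => h.n₀₂ k.symm) (fun k => hu.2.2.2.1 k.symm)
      (fun k => n₃ k.symm) h.n₃₀ (fun k => hu.2.2.2.2 k.symm)
  have hb := h.not_adj_near hH hu hv.2.1
  have hb' := h.reflect.not_adj_near hH (isNear_reflect hu) hv.2.2.2.2
  have hc := h.adj_near hH hu hv.2.2.2.1
  have hc' := h.reflect.adj_near hH (isNear_reflect hu) hv.2.2.1
  have hd := h.rotate.rotate.rotate.rotate.adj_of_common hH huv hu.1 hu.2.2.1
  unfold IsNear at hv₁ hv₄
  by_cases v₀ : H.Adj v x₀ <;> by_cases v₁ : H.Adj v x₁ <;> by_cases v₂ : H.Adj v x₂ <;>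
    by_cases v₃ : H.Adj v x₃ <;> by_cases v₄ : H.Adj v x₄ <;>
    simp only [v₀, v₁, v₂, v₃, v₄, true_implies, false_implies, not_true, not_false_eq_true,
      imp_false, and_true, and_false, or_true, or_false, iff_true, iff_false] at * <;>
    assumption

end IsInducedC5

/-! ### Sparse and full vertices around a `C₅`. -/

/-- `v` misses three consecutive vertices of the cycle `c`. -/
def IsSparse {V : Type u} (H : SimpleGraph V) (c : Fin 5 → V) (v : V) : Prop :=
  ∃ i, ¬ H.Adj v (c i) ∧ ¬ H.Adj v (c (i + 1)) ∧ ¬ H.Adj v (c (i + 2))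

/-- `c` is an induced five-cycle. -/
def IsC5Map {V : Type u} (H : SimpleGraph V) (c : Fin 5 → V) : Prop :=
  ∀ i, H.IsInducedC5 (c i) (c (i + 1)) (c (i + 2)) (c (i + 3)) (c (i + 4))

theorem IsInducedC5.isC5Map {V : Type u} {H : SimpleGraph V} {x₀ x₁ x₂ x₃ x₄ : V}
    (h : H.IsInducedC5 x₀ x₁ x₂ x₃ x₄) : H.IsC5Map ![x₀, x₁, x₂, x₃, x₄] := by
  intro i
  fin_cases i
  · exact h
  · exact h.rotate
  · exact h.rotate.rotate
  · exact h.rotate.rotate.rotate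
  · exact h.rotate.rotate.rotate.rotate

namespace IsC5Map

variable {V : Type u} {H : SimpleGraph V} {c : Fin 5 → V}

theorem ne_of_isSparse (hc : H.IsC5Map c) {v : V} (hv : H.IsSparse c v) (j : Fin 5) :
    v ≠ c j := by
  rintro rfl
  obtain ⟨i, h₀, h₁, h₂⟩ := hv
  have hj : ∀ i j : Fin 5, j = i ∨ j = i + 1 ∨ j = i + 2 ∨ j = i + 3 ∨ j = i + 4 := by decide
  rcases hj i j with rfl | rfl | rfl | rfl | rfl
  · exact h₁ (hc j).a₀₁
  · exact h₀ (hc i).a₀₁.symm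
  · exact h₁ (hc i).a₁₂.symm
  · exact h₂ (hc i).a₂₃.symm
  · exact h₀ (hc i).a₄₀

theorem type_cases (hc : H.IsC5Map c) (hH : H.IsCoAtomLike) {v : V} (hv : ∀ i, v ≠ c i) :
    (∀ i, H.Adj v (c i)) ∨
      (∃ i, H.IsNear (c i) (c (i + 1)) (c (i + 2)) (c (i + 3)) (c (i + 4)) v) ∨
      H.IsSparse c v := by
  classical
  have key : ∀ t : Fin 5 → Bool, (∀ i, t i = true → t (i + 2) = true → t (i + 1) = true) →
      (∀ i, t i = true) ∨ (∃ i, t (i + 4) = true ∧ t i = true ∧ t (i + 1) = true ∧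
        ¬ t (i + 2) = true ∧ ¬ t (i + 3) = true) ∨
      ∃ i, ¬ t i = true ∧ ¬ t (i + 1) = true ∧ ¬ t (i + 2) = true := by decide
  have := key (fun i => decide (H.Adj v (c i))) (fun i h₀ h₂ => by
    simp only [decide_eq_true_eq] at h₀ h₂ ⊢
    exact (hc i).adj_middle hH (hv _) h₀ h₂)
  simp only [decide_eq_true_eq] at this
  exact this

/-- Three consecutive cycle vertices missed by both ends form a `P₃` anticomplete to the supposed
edge. -/
theorem not_adj_of_same_type (hc : H.IsC5Map c) (hH : H.IsCoAtomLike) {u v : V}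
    (hu : H.IsSparse c u) (huv : ∀ i, H.Adj u (c i) ↔ H.Adj v (c i)) : ¬ H.Adj u v := by
  intro k
  obtain ⟨i, h₀, h₁, h₂⟩ := hu
  exact hH.noP2P3 u v (c i) (c (i + 1)) (c (i + 2)) k (hc i).a₀₁ (hc i).a₁₂ (hc i).ne₀₂ (hc i).n₀₂
    h₀ h₁ h₂ (fun k => h₀ ((huv _).2 k)) (fun k => h₁ ((huv _).2 k)) (fun k => h₂ ((huv _).2 k))

/-- A sparse vertex has at most one sparse neighbour of each type. -/
theorem eq_of_same_type (hc : H.IsC5Map c) (hH : H.IsCoAtomLike) {u u' v : V}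
    (hv : H.IsSparse c v) (hu : H.IsSparse c u) (huu' : ∀ i, H.Adj u (c i) ↔ H.Adj u' (c i))
    (hvu : H.Adj v u) (hvu' : H.Adj v u') : u = u' := by
  by_contra e
  have hn := hc.not_adj_of_same_type hH hu huu'
  -- A cycle neighbour of `u` and `u'` that `v` misses closes a `C₄`. Otherwise `u` and `u'` also
  -- miss a cycle edge missed by `v`, which joins `u v u'` in a `P₂ + P₃`.
  by_cases hj : ∃ j, H.Adj u (c j) ∧ ¬ H.Adj v (c j)
  · obtain ⟨j, huj, hvj⟩ := hj
    exact hH.noC4 u (c j) u' v huj ((huu' j).1 huj).symm hvu'.symm hvu e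
      (hc.ne_of_isSparse hv j).symm hn (fun k => hvj k.symm)
  · push Not at hj
    obtain ⟨i, h₀, h₁, -⟩ := hv
    have n₀ : ¬ H.Adj u (c i) := fun k => h₀ (hj _ k)
    have n₁ : ¬ H.Adj u (c (i + 1)) := fun k => h₁ (hj _ k)
    exact hH.noP2P3 (c i) (c (i + 1)) u v u' (hc i).a₀₁ hvu.symm hvu' e hn (fun k => n₀ k.symm)
      (fun k => h₀ k.symm) (fun k => n₀ ((huu' _).2 k.symm)) (fun k => n₁ k.symm)
      (fun k => h₁ k.symm) (fun k => n₁ ((huu' _).2 k.symm))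

theorem adj_of_full (hc : H.IsC5Map c) (hH : H.IsCoAtomLike) {u v : V} (huv : u ≠ v)
    (hu : ∀ i, H.Adj u (c i)) (hv : ∀ i, H.Adj v (c i)) : H.Adj u v :=
  (hc 0).adj_of_common hH huv (hu _) (hu _) (hv _) (hv _)

/-- A vertex complete to the cycle misses an edge between sparse vertices. -/
theorem exists_missed_sparse (hc : H.IsC5Map c) (hH : H.IsCoAtomLike) {z : V}
    (hz : ∀ i, H.Adj z (c i)) : ∃ x y, H.IsSparse c x ∧ H.IsSparse c y ∧ H.Adj x y ∧
      ¬ H.Adj z x ∧ ¬ H.Adj z y := by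
  obtain ⟨x, y, hxy, hzx, hzy⟩ := hH.exists_missed z (c 0) (hz 0)
  have key : ∀ x y, H.Adj x y → ¬ H.Adj z x → ¬ H.Adj z y → H.IsSparse c x := by
    intro x y hxy hzx hzy
    have hx : ∀ i, x ≠ c i := fun i e => hzx (e ▸ hz i)
    have hxz : z ≠ x := fun e => hzy (e ▸ hxy)
    rcases hc.type_cases hH hx with k | ⟨i, k⟩ | k
    · exact absurd (hc.adj_of_full hH hxz hz k) hzx
    · exact absurd ((hc i).rotate.rotate.rotate.rotate.adj_of_common hH hxz (hz _) (hz _) k.1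
        k.2.2.1) hzx
    · exact k
  exact ⟨x, y, key x y hxy hzx hzy, key y x hxy.symm hzy hzx, hxy, hzx, hzy⟩

open scoped Classical in
/-- The sparse neighbours of `v`. -/
noncomputable def sparseNbrs [Fintype V] (H : SimpleGraph V) (c : Fin 5 → V) (v : V) : Finset V :=
  Finset.univ.filter fun w => H.IsSparse c w ∧ H.Adj v w

theorem mem_sparseNbrs [Fintype V] {v w : V} :
    w ∈ sparseNbrs H c v ↔ H.IsSparse c w ∧ H.Adj v w := by
  simp [sparseNbrs]

theorem card_le_of_types {H : SimpleGraph V} {c : Fin 5 → V} (X : Finset V)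
    (hX : ∀ u ∈ X, ∀ v ∈ X, (∀ i, H.Adj u (c i) ↔ H.Adj v (c i)) → u = v) : X.card ≤ 32 := by
  classical
  have := Finset.card_le_card_of_injOn (s := X) (t := (Finset.univ : Finset (Fin 5 → Bool)))
    (fun v i => decide (H.Adj v (c i))) (fun _ _ => Finset.mem_coe.2 (Finset.mem_univ _))
    (fun u hu v hv huv => hX u hu v hv fun i => by simpa using congrFun huv i)
  simpa using this

theorem card_sparseNbrs_le [Fintype V] (hc : H.IsC5Map c) (hH : H.IsCoAtomLike) {v : V}
    (hv : H.IsSparse c v) : (sparseNbrs H c v).card ≤ 32 := by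
  refine card_le_of_types (H := H) (c := c) _ fun u hu w hw huw => ?_
  rw [mem_sparseNbrs] at hu hw
  exact hc.eq_of_same_type hH hv hu.1 huw hu.2 hw.2

theorem card_clique_le (hc : H.IsC5Map c) (hH : H.IsCoAtomLike) {X : Finset V}
    (hX : ∀ u ∈ X, H.IsSparse c u) (hX' : ∀ u ∈ X, ∀ v ∈ X, u ≠ v → H.Adj u v) : X.card ≤ 32 := by
  refine card_le_of_types (H := H) (c := c) _ fun u hu w hw huw => ?_
  by_contra e
  exact hc.not_adj_of_same_type hH (hX u hu) huw (hX' u hu w hw e)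

theorem card_sparseNbrs_full_le [Fintype V] (hc : H.IsC5Map c) (hH : H.IsCoAtomLike) {z : V}
    (hz : ∀ i, H.Adj z (c i)) : (sparseNbrs H c z).card ≤ 96 := by
  classical
  obtain ⟨x, y, hx, hy, hxy, hzx, hzy⟩ := hc.exists_missed_sparse hH hz
  -- Neighbours of `z` missing the edge `xy` form a clique: otherwise two of them with `z` in the
  -- middle give a `P₃` anticomplete to `xy`. This yields `96 = 32 + 32 + 32`.
  let R := (sparseNbrs H c z).filter fun q => ¬ H.Adj x q ∧ ¬ H.Adj y q
  have hR : R.card ≤ 32 := by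
    refine hc.card_clique_le hH (fun u hu => (mem_sparseNbrs.1 (Finset.mem_filter.1 hu).1).1) ?_
    intro u hu v hv huv
    obtain ⟨hu, hxu, hyu⟩ := Finset.mem_filter.1 hu
    obtain ⟨hv, hxv, hyv⟩ := Finset.mem_filter.1 hv
    by_contra k
    exact hH.noP2P3 x y u z v hxy (mem_sparseNbrs.1 hu).2.symm (mem_sparseNbrs.1 hv).2 huv k hxu
      (fun k => hzx k.symm) hxv hyu (fun k => hzy k.symm) hyv
  have hsub : sparseNbrs H c z ⊆ sparseNbrs H c x ∪ sparseNbrs H c y ∪ R := by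
    intro q hq
    have hq' := (mem_sparseNbrs.1 hq).1
    simp only [Finset.mem_union, R, Finset.mem_filter, mem_sparseNbrs (v := x),
      mem_sparseNbrs (v := y)]
    tauto
  have h₁ := Finset.card_le_card hsub
  have h₂ := Finset.card_union_le (sparseNbrs H c x ∪ sparseNbrs H c y) R
  have h₃ := Finset.card_union_le (sparseNbrs H c x) (sparseNbrs H c y)
  have h₄ := hc.card_sparseNbrs_le hH hx
  have h₅ := hc.card_sparseNbrs_le hH hy
  omega

/-- There is a bounded set of edges between sparse vertices such that each vertex complete to the
cycle misses one of them. -/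
theorem exists_edges [Fintype V] (hc : H.IsC5Map c) (hH : H.IsCoAtomLike) :
    ∃ E : Finset (V × V), E.card ≤ 6145 ∧
      (∀ e ∈ E, H.IsSparse c e.1 ∧ H.IsSparse c e.2 ∧ H.Adj e.1 e.2) ∧
      ∀ z, (∀ i, H.Adj z (c i)) → ∃ e ∈ E, ¬ H.Adj z e.1 ∧ ¬ H.Adj z e.2 := by
  classical
  let EQ : Finset (V × V) :=
    Finset.univ.filter fun e => H.IsSparse c e.1 ∧ H.IsSparse c e.2 ∧ H.Adj e.1 e.2
  have hEQ : ∀ e, e ∈ EQ ↔ H.IsSparse c e.1 ∧ H.IsSparse c e.2 ∧ H.Adj e.1 e.2 := by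
    intro e
    simp [EQ]
  -- A full vertex has at most 96 sparse neighbours, each in at most 32 sparse edges. In ordered
  -- pairs it touches at most `2 * 96 * 32 = 6144`, so any 6145 of them include one it misses.
  by_cases hcard : EQ.card ≤ 6145
  · refine ⟨EQ, hcard, fun e he => (hEQ e).1 he, fun z hz => ?_⟩
    obtain ⟨x, y, hx, hy, hxy, hzx, hzy⟩ := hc.exists_missed_sparse hH hz
    exact ⟨(x, y), (hEQ _).2 ⟨hx, hy, hxy⟩, hzx, hzy⟩
  · obtain ⟨E, hE, hEcard⟩ := Finset.exists_subset_card_eq (show 6145 ≤ EQ.card by omega)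
    refine ⟨E, hEcard.le, fun e he => (hEQ e).1 (hE he), fun z hz => ?_⟩
    by_contra! hcon
    have hsub : E ⊆ (sparseNbrs H c z).biUnion (fun x => (sparseNbrs H c x).image fun y => (x, y)) ∪
        (sparseNbrs H c z).biUnion (fun y => (sparseNbrs H c y).image fun x => (x, y)) := by
      rintro ⟨x, y⟩ he
      obtain ⟨hx, hy, hxy⟩ := (hEQ _).1 (hE he)
      rw [Finset.mem_union, Finset.mem_biUnion, Finset.mem_biUnion]
      by_cases hzx : H.Adj z x
      · exact Or.inl ⟨x, mem_sparseNbrs.2 ⟨hx, hzx⟩,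
          Finset.mem_image.2 ⟨y, mem_sparseNbrs.2 ⟨hy, hxy⟩, rfl⟩⟩
      · exact Or.inr ⟨y, mem_sparseNbrs.2 ⟨hy, hcon _ he hzx⟩,
          Finset.mem_image.2 ⟨x, mem_sparseNbrs.2 ⟨hx, hxy.symm⟩, rfl⟩⟩
    have h₁ := (Finset.card_le_card hsub).trans (Finset.card_union_le _ _)
    have h₂ := Finset.card_biUnion_le_card_mul (sparseNbrs H c z)
      (fun x => (sparseNbrs H c x).image fun y => (x, y)) 32 (fun x hx =>
        Finset.card_image_le.trans (hc.card_sparseNbrs_le hH (mem_sparseNbrs.1 hx).1))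
    have h₃ := Finset.card_biUnion_le_card_mul (sparseNbrs H c z)
      (fun y => (sparseNbrs H c y).image fun x => (x, y)) 32 (fun x hx =>
        Finset.card_image_le.trans (hc.card_sparseNbrs_le hH (mem_sparseNbrs.1 hx).1))
    have h₄ := hc.card_sparseNbrs_full_le hH hz
    omega

/-- Outside of a bounded set, the sparse vertices are anticomplete to the vertices complete to the
cycle. -/
theorem exists_sparse_full [Fintype V] (hc : H.IsC5Map c) (hH : H.IsCoAtomLike) :
    ∃ S : Finset V, S.card ≤ 6145 * 96 ∧ ∀ z q, (∀ i, H.Adj z (c i)) → H.IsSparse c q → q ∉ S →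
      ¬ H.Adj z q := by
  classical
  obtain ⟨E, hEcard, hE, hEz⟩ := hc.exists_edges hH
  -- The remaining troublesome vertices for `e` form a clique: full vertices missing `e` and
  -- adjacent to some member of `B e` have the same neighbours there, and a common full neighbour of
  -- two non-adjacent members would give a `P₃` missed by `e`.
  let B : V × V → Finset V := fun e => Finset.univ.filter fun q => H.IsSparse c q ∧
    ¬ H.Adj e.1 q ∧ ¬ H.Adj e.2 q ∧
      ∃ z, (∀ i, H.Adj z (c i)) ∧ ¬ H.Adj z e.1 ∧ ¬ H.Adj z e.2 ∧ H.Adj z q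
  have hB : ∀ e ∈ E, (B e).card ≤ 32 := by
    intro e he
    refine hc.card_clique_le hH (fun u hu => (Finset.mem_filter.1 hu).2.1) ?_
    intro u hu v hv huv
    obtain ⟨-, hu, hu₁, hu₂, z, hz, hz₁, hz₂, hzu⟩ := Finset.mem_filter.1 hu
    obtain ⟨-, hv, hv₁, hv₂, z', hz', hz'₁, hz'₂, hzv⟩ := Finset.mem_filter.1 hv
    have hexy := (hE e he).2.2
    have huz' : H.Adj z' u := by
      by_cases ezz : z = z'
      · exact ezz ▸ hzu
      by_contra k
      have huz : u ≠ z' := by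
        rintro rfl
        obtain ⟨i, hi, -⟩ := hu
        exact hi (hz' i)
      exact hH.noP2P3 e.1 e.2 u z z' hexy hzu.symm (hc.adj_of_full hH ezz hz hz') huz
        (fun k' => k k'.symm) hu₁ (fun k => hz₁ k.symm) (fun k => hz'₁ k.symm) hu₂
        (fun k => hz₂ k.symm) (fun k => hz'₂ k.symm)
    by_contra k
    exact hH.noP2P3 e.1 e.2 u z' v hexy huz'.symm hzv huv k hu₁ (fun k => hz'₁ k.symm) hv₁ hu₂
      (fun k => hz'₂ k.symm) hv₂
  refine ⟨E.biUnion fun e => sparseNbrs H c e.1 ∪ sparseNbrs H c e.2 ∪ B e, ?_, ?_⟩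
  · refine (Finset.card_biUnion_le_card_mul _ _ 96 fun e he => ?_).trans
      (Nat.mul_le_mul_right 96 hEcard)
    have h₁ := Finset.card_union_le (sparseNbrs H c e.1 ∪ sparseNbrs H c e.2) (B e)
    have h₂ := Finset.card_union_le (sparseNbrs H c e.1) (sparseNbrs H c e.2)
    have h₃ := hc.card_sparseNbrs_le hH (hE e he).1
    have h₄ := hc.card_sparseNbrs_le hH (hE e he).2.1
    have h₅ := hB e he
    omega
  · intro z q hz hq hqS hzq
    obtain ⟨e, he, hz₁, hz₂⟩ := hEz z hz
    refine hqS (Finset.mem_biUnion.2 ⟨e, he, ?_⟩)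
    simp only [Finset.mem_union, mem_sparseNbrs, B, Finset.mem_filter, Finset.mem_univ, true_and]
    by_cases h₁ : H.Adj e.1 q
    · exact Or.inl (Or.inl ⟨hq, h₁⟩)
    by_cases h₂ : H.Adj e.2 q
    · exact Or.inl (Or.inr ⟨hq, h₂⟩)
    exact Or.inr ⟨hq, h₁, h₂, z, hz, hz₁, hz₂, hzq⟩

/-- Outside of a bounded set, the sparse vertices induce a disjoint union of cliques. -/
theorem exists_sparse_cliques [Fintype V] (hc : H.IsC5Map c) (hH : H.IsCoAtomLike) :
    ∃ S : Finset V, S.card ≤ 96 ∧ ∀ u v w, H.IsSparse c u → H.IsSparse c v → H.IsSparse c w →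
      u ∉ S → v ∉ S → w ∉ S → H.Adj u v → H.Adj v w → u ≠ w → H.Adj u w := by
  classical
  by_cases hP : ∃ p q r, H.IsSparse c p ∧ H.IsSparse c q ∧ H.IsSparse c r ∧ H.Adj p q ∧
      H.Adj q r ∧ p ≠ r ∧ ¬ H.Adj p r
  · obtain ⟨p, q, r, hp, hq, hr, hpq, hqr, hpr, npr⟩ := hP
    -- Every edge between sparse vertices touches the neighbourhood of an induced `P₃`, so deleting
    -- these neighbourhoods destroys all such edges.
    refine ⟨sparseNbrs H c p ∪ sparseNbrs H c q ∪ sparseNbrs H c r, ?_, ?_⟩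
    · have h₁ := Finset.card_union_le (sparseNbrs H c p ∪ sparseNbrs H c q) (sparseNbrs H c r)
      have h₂ := Finset.card_union_le (sparseNbrs H c p) (sparseNbrs H c q)
      have h₃ := hc.card_sparseNbrs_le hH hp
      have h₄ := hc.card_sparseNbrs_le hH hq
      have h₅ := hc.card_sparseNbrs_le hH hr
      omega
    · intro u v w hu hv _ huS hvS _ huv _ _
      simp only [Finset.mem_union, mem_sparseNbrs, hu, hv, true_and, not_or] at huS hvS
      exact (hH.noP2P3 u v p q r huv hpq hqr hpr npr (fun k => huS.1.1 k.symm)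
        (fun k => huS.1.2 k.symm) (fun k => huS.2 k.symm) (fun k => hvS.1.1 k.symm)
        (fun k => hvS.1.2 k.symm) (fun k => hvS.2 k.symm)).elim
  · refine ⟨∅, by simp, fun u v w hu hv hw _ _ _ huv hvw huw => ?_⟩
    by_contra k
    exact hP ⟨u, v, w, hu, hv, hw, huv, hvw, huw, k⟩

theorem exists_near_exceptional (hc : H.IsC5Map c) (hH : H.IsCoAtomLike) (i : Fin 5) :
    ∃ T : Finset V, T.card ≤ 2 ∧ ∀ u v,
      H.IsNear (c i) (c (i + 1)) (c (i + 2)) (c (i + 3)) (c (i + 4)) u →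
      H.IsNear (c (i + 1)) (c (i + 2)) (c (i + 3)) (c (i + 4)) (c i) v →
      u ∉ T → v ∉ T → H.Adj u v := by
  classical
  by_cases h : ∃ u v, H.IsNear (c i) (c (i + 1)) (c (i + 2)) (c (i + 3)) (c (i + 4)) u ∧
      H.IsNear (c (i + 1)) (c (i + 2)) (c (i + 3)) (c (i + 4)) (c i) v ∧ ¬ H.Adj u v
  · obtain ⟨u, v, hu, hv, huv⟩ := h
    refine ⟨{u, v}, Finset.card_le_two, fun u' v' hu' hv' huT _ => ?_⟩
    by_contra k
    have := (hc i).near_exceptional hH hu hv huv hu' hv' k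
    exact huT (by simp [this.1])
  · push Not at h
    exact ⟨∅, by simp, fun u v hu hv _ _ => h u v hu hv⟩

end IsC5Map

theorem exists_bound_of_C5 : ∃ k : ℕ, ∀ (V : Type u) [Finite V] (H : SimpleGraph V),
    H.IsCoAtomLike → ∀ c : Fin 5 → V, H.IsC5Map c → Hᶜ.cliqueWidth ≤ k := by
  classical
  -- The summands count the cycle, two exceptional vertices for each of the five positions, and the
  -- sets making sparse vertices anticomplete to full ones and a union of cliques. The value stays
  -- abstract, so `2 ^ s` is symbolic.
  obtain ⟨s, hs⟩ : ∃ s : ℕ, 5 + 10 + 6145 * 96 + 96 ≤ s := ⟨_, le_rfl⟩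
  refine ⟨s + 2 ^ s + 32 + 1, fun V _ H hH c hc => ?_⟩
  have := Fintype.ofFinite V
  obtain ⟨S₁, hS₁, hS₁'⟩ := hc.exists_sparse_full hH
  obtain ⟨S₂, hS₂, hS₂'⟩ := hc.exists_sparse_cliques hH
  choose T hT hT' using hc.exists_near_exceptional hH
  let S := Finset.univ.image c ∪ Finset.univ.biUnion T ∪ S₁ ∪ S₂
  have hS : S.card ≤ s := by
    have h₁ := Finset.card_union_le (Finset.univ.image c ∪ Finset.univ.biUnion T ∪ S₁) S₂
    have h₂ := Finset.card_union_le (Finset.univ.image c ∪ Finset.univ.biUnion T) S₁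
    have h₃ := Finset.card_union_le (Finset.univ.image c) (Finset.univ.biUnion T)
    have h₄ : (Finset.univ.image c).card ≤ 5 := Finset.card_image_le.trans (by simp)
    have h₅ : (Finset.univ.biUnion T).card ≤ 5 * 2 :=
      (Finset.card_biUnion_le_card_mul _ _ 2 fun i _ => hT i).trans (by simp)
    change (Finset.univ.image c ∪ Finset.univ.biUnion T ∪ S₁ ∪ S₂).card ≤ s
    omega
  have hcS : ∀ i, c i ∈ S := fun i => by simp [S]
  have hSc : ∀ v, v ∉ S → ∀ i, v ≠ c i := fun v hv i e => hv (e ▸ hcS i)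
  have hST : ∀ v, v ∉ S → ∀ i, v ∉ T i := fun v hv i h => hv (by
    simp only [S, Finset.mem_union, Finset.mem_biUnion]
    exact Or.inl (Or.inl (Or.inr ⟨i, Finset.mem_univ i, h⟩)))
  have hS1 : ∀ v, v ∉ S → v ∉ S₁ := fun v hv h => hv (by simp [S, h])
  have hS2 : ∀ v, v ∉ S → v ∉ S₂ := fun v hv h => hv (by simp [S, h])
  -- The slot of a vertex is its trace on the cycle: adjacent sparse vertices never share a trace.
  let e : (Fin 5 → Bool) ≃ Fin 32 := Fintype.equivFinOfCardEq (by simp)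
  have hnear : ∀ i u v, H.IsNear (c i) (c (i + 1)) (c (i + 2)) (c (i + 3)) (c (i + 4)) u →
      u ∉ S → v ∉ S → u ≠ v → (H.Adj u v ↔ H.Adj v (c i) ∨
        (H.Adj v (c (i + 1)) ∧ H.Adj v (c (i + 2)) ∧ ¬ H.Adj v (c (i + 3))) ∨
        (H.Adj v (c (i + 4)) ∧ H.Adj v (c (i + 3)) ∧ ¬ H.Adj v (c (i + 2)))) := by
    intro i u v hu huS hvS huv
    have hv := hSc v hvS
    refine (hc i).adj_near_iff hH hu huv ⟨hv _, hv _, hv _, hv _, hv _⟩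
      (fun k => hT' i u v hu k (hST u huS i) (hST v hvS i)) fun k => ?_
    have hi : ∀ i : Fin 5, i + 4 + 1 = i ∧ i + 4 + 2 = i + 1 ∧ i + 4 + 3 = i + 2 ∧
        i + 4 + 4 = i + 3 := by decide
    obtain ⟨i₁, i₂, i₃, i₄⟩ := hi i
    have := hT' (i + 4) v u
    rw [i₁, i₂, i₃, i₄] at this
    exact (this k hu (hST v hvS _) (hST u huS _)).symm
  refine cliqueWidth_compl_le_of_small_classes H S hS
    (fun u v => H.IsSparse c u ∧ H.IsSparse c v ∧ (u = v ∨ H.Adj u v))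
    (fun u v _ _ k => ⟨k.2.1, k.1, k.2.2.imp Eq.symm (·.symm)⟩) ?_
    (fun v => e fun i => decide (H.Adj v (c i))) ?_ ?_
  · rintro u v w huS hvS hwS ⟨hu, hv, h₁⟩ ⟨_, hw, h₂⟩
    refine ⟨hu, hw, ?_⟩
    rcases h₁ with rfl | h₁
    · exact h₂
    rcases h₂ with rfl | h₂
    · exact Or.inr h₁
    by_cases huw : u = w
    · exact Or.inl huw
    exact Or.inr (hS₂' u v w hu hv hw (hS2 u huS) (hS2 v hvS) (hS2 w hwS) h₁ h₂ huw)
  · rintro u v _ _ ⟨hu, -, h₁⟩ hslot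
    refine h₁.resolve_right (hc.not_adj_of_same_type hH hu fun i => ?_)
    simpa using congrFun (e.injective hslot) i
  · intro u v u' v' hu hv hu' hv' huv huv' hr hr' h₁ h₂ hadj
    have h₁ := fun i => h₁ (c i) (hcS i)
    have h₂ := fun i => h₂ (c i) (hcS i)
    rcases hc.type_cases hH (hSc u hu) with ku | ⟨i, ku⟩ | ku
    rotate_left
    · have ku' : H.IsNear (c i) (c (i + 1)) (c (i + 2)) (c (i + 3)) (c (i + 4)) u' := by
        unfold IsNear at ku ⊢
        simpa only [h₁] using ku
      rw [hnear i u v ku hu hv huv] at hadj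
      rw [hnear i u' v' ku' hu' hv' huv']
      simpa only [h₂] using hadj
    all_goals
      rcases hc.type_cases hH (hSc v hv) with kv | ⟨i, kv⟩ | kv
      rotate_left
      · have kv' : H.IsNear (c i) (c (i + 1)) (c (i + 2)) (c (i + 3)) (c (i + 4)) v' := by
          unfold IsNear at kv ⊢
          simpa only [h₂] using kv
        rw [H.adj_comm, hnear i v u kv hv hu huv.symm] at hadj
        rw [H.adj_comm, hnear i v' u' kv' hv' hu' huv'.symm]
        simpa only [h₁] using hadj
    · exact absurd ⟨ku, kv, Or.inr hadj⟩ hr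
    · exact absurd hadj.symm (hS₁' v u kv ku (hS1 u hu))
    · exact absurd hadj (hS₁' u v ku kv (hS1 v hv))
    · exact hc.adj_of_full hH huv' (fun i => (h₁ i).1 (ku i)) fun i => (h₂ i).1 (kv i)

/-! ### Conclusion. -/

theorem hasBoundedCliqueWidth_atoms :
    HasBoundedCliqueWidth.{u} (fun G => G.IsTwoP2CoP2P3Free ∧ G.IsGraphAtom) := by
  obtain ⟨k, hk⟩ := exists_bound_of_C5.{u}
  refine ⟨k + 73, fun V _ G hG => ?_⟩
  have hH := IsCoAtomLike.of_compl hG.1 hG.2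
  rw [← compl_compl G]
  by_cases hbot : Gᶜ = ⊥
  · exact (cliqueWidth_compl_le_of_transitive Gᶜ fun p q r hpq => by
      rw [hbot] at hpq
      exact hpq.elim).trans (by omega)
  by_cases hC5 : ∃ x₀ x₁ x₂ x₃ x₄, Gᶜ.IsInducedC5 x₀ x₁ x₂ x₃ x₄
  · obtain ⟨x₀, x₁, x₂, x₃, x₄, h⟩ := hC5
    exact (hk V Gᶜ hH _ h.isC5Map).trans (by omega)
  · obtain ⟨a, b, c, d, hab, hcd, nac, nad, nbc, nbd⟩ :=
      (hH.exists_C5_or_2P2 hbot).resolve_left hC5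
    push Not at hC5
    exact (IsInduced2P2.cliqueWidth_compl_le ⟨hab, hcd, nac, nad, nbc, nbd⟩ hH hC5).trans
      (by omega)

end SimpleGraph

theorem theorem2 :
    HasBoundedCliqueWidth.{u} (fun G => G.IsTwoP2CoP2P3Free ∧ G.IsGraphAtom) ∧
    ¬ HasBoundedCliqueWidth.{u} (fun G => G.IsTwoP2CoP2P3Free) ∧
    (∀ (V : Type u) [Finite V] (G : SimpleGraph V),
      G.IsSplitGraph → G.IsTwoP2CoP2P3Free) ∧
    ¬ HasBoundedCliqueWidth.{u} (fun G => G.IsSplitGraph) := by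
  refine ⟨hasBoundedCliqueWidth_atoms, fun ⟨c, hc⟩ => ?_,
    fun V _ G hG => hG.isTwoP2CoP2P3Free, not_hasBoundedCliqueWidth_isSplitGraph⟩
  exact not_hasBoundedCliqueWidth_isSplitGraph
    ⟨c, fun V _ G hG => hc V G hG.isTwoP2CoP2P3Free⟩
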